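/- Let $(T,\Sigma,\mu)$ be a non-atomic, $\sigma$-finite measure space, and let $\Phi\colon T\times[0,\infty]\to[0,\infty]$ be a Musielak--Orlicz function: for $\mu$-a.e. $t$, $\Phi(t,\cdot)$ is convex and lower semicontinuous, $\Phi(t,0)=\lim_{x\downarrow 0}\Phi(t,x)=0$ and $\Phi(t,\infty)=\infty$; and $\Phi(\cdot,x)$ is measurable for all $x\ge 0$. Let $\Phi^*(t,y)=\sup_{x>0}(xy-\Phi(t,x))$ be the complementary function and $b_{\Phi^*}(t)=\sup\{y\ge 0:\Phi^*(t,y)<\infty\}\in[0,\infty]$. For $\Psi\in\{\Phi,\Phi^*\}$ and a real measurable function $u$ (identified up to $\mu$-a.e. equality) put $I_\Psi(u)=\int_T\Psi(t,|u(t)|)\,d\mu$, and let $L^\Psi$ be the space of those $u$ with $I_\Psi(\lambda u)<\infty$ for some $\lambda>0$. Let $L_0^\Phi$ be $L^\Phi$ with the Orlicz norm $\|u\|_{\Phi,0}=\sup\{|\int_T uv\,d\mu| : I_{\Phi^*}(v)\le 1\}$. On the dual $(L_0^\Phi)^*$ let $\|\cdot\|$ be the dual norm. For $u\in L^\Phi$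 let $K(u)$ be the set of all $k>0$ at which $\inf_{k>0}\frac1k(1+I_\Phi(ku))$ is attained. A positive functional $F$ on $L^\Phi$ has the order continuous component $F_c$ given by $F_c(u)=\inf\{\sup_n F(u_n):0\le u_n\uparrow u\}$ for $u\ge 0$. For general $f\in(L_0^\Phi)^*$ with positive and negative parts $f^\pm$ (where $f^+(u)=\sup\{f(w):0\le w\le u\}$ for $u\ge0$, and $f^-=(-f)^+$), $f_c=(f^+)_c-(f^-)_c$; $f$ is purely singular if $f_c=0$. Let $u\in L_0^\Phi\setminus\{0\}$ be such that $K(u)=\emptyset$. Let $f\in(L_0^\Phi)^*$ be written as $f=f_v+f_s$, where $f_v(w)=\int_T wv\,d\mu$ with $v\in L^{\Phi^*}$, and $f_s\in(L_0^\Phi)^*$ is purely singular. Then $f$ is a support functional at $u$, i.e. $\|f\|=1$ and $f(u)=\|u\|_{\Phi,0}$, if and only if (i) $I_{\Phi^*}(v)+\|f_s\|\le 1$, and (ii) $v(t)=\operatorname{sgn}u(t)\cdot b_{\Phi^*}(t)$ for $\mu$-a.e. $t\in\operatorname{supp}u=\{t\in T: |u(t)|>0\}$. -/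

import Mathlib

open MeasureTheory Filter Topology Set
open scoped ENNReal NNReal

noncomputable section

/-- A measure is non-atomic if every measurable set of positive measure contains a measurable
subset of strictly smaller positive measure. -/
def NonatomicMeasure {T : Type*} [MeasurableSpace T] (μ : Measure T) : Prop :=
  ∀ A : Set T, MeasurableSet A → 0 < μ A → ∃ B ⊆ A, MeasurableSet B ∧ 0 < μ B ∧ μ B < μ A

/-- Musielak--Orlicz functions `Φ : T × [0,∞] → [0,∞]`. -/
structure MusielakOrliczFunction {T : Type*} [MeasurableSpace T] (μ : Measure T) where
  toFun : T → ℝ≥0∞ → ℝ≥0∞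
  convexOn : ∀ᵐ t ∂μ, ConvexOn ℝ≥0 univ (toFun t)
  lowerSemicontinuous : ∀ᵐ t ∂μ, LowerSemicontinuous (toFun t)
  map_zero : ∀ᵐ t ∂μ, toFun t 0 = 0
  tendsto_zero : ∀ᵐ t ∂μ, Tendsto (toFun t) (𝓝[>] 0) (𝓝 0)
  map_top : ∀ᵐ t ∂μ, toFun t ∞ = ∞
  measurable : ∀ x : ℝ≥0, Measurable fun t => toFun t x

/-- The complementary function `Φ*(t,y) = sup_{x>0} (x y - Φ(t,x))`, `0 < x < ∞`. Subtraction in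
`[0,∞]` is truncated at `0`, which does not change the supremum, because
`x y - Φ(t,x) ≥ -Φ(t,x) → 0` as `x ↓ 0`. -/
def complementary {T : Type*} (Φ : T → ℝ≥0∞ → ℝ≥0∞) (t : T) (y : ℝ≥0∞) : ℝ≥0∞ :=
  ⨆ (x : ℝ≥0) (_ : 0 < x), ((x : ℝ≥0∞) * y - Φ t x)

/-- `b_Φ(t) = sup {x ≥ 0 : Φ(t,x) < ∞}`. -/
def finiteBound {T : Type*} (Φ : T → ℝ≥0∞ → ℝ≥0∞) (t : T) : ℝ≥0∞ :=
  sSup {x | Φ t x < ∞}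

/-- The modular `I_Φ(u) = ∫ Φ(t,|u(t)|) dμ`. -/
def modular {T : Type*} [MeasurableSpace T] (μ : Measure T) (Φ : T → ℝ≥0∞ → ℝ≥0∞)
    (u : T → ℝ) : ℝ≥0∞ :=
  ∫⁻ t, Φ t ‖u t‖ₑ ∂μ

/-- Membership in `L^Φ`: `I_Φ(c u) < ∞` for some `c > 0`. -/
def MemMusielakOrlicz {T : Type*} [MeasurableSpace T] (μ : Measure T) (Φ : T → ℝ≥0∞ → ℝ≥0∞)
    (u : T → ℝ) : Prop :=
  ∃ c : ℝ, 0 < c ∧ modular μ Φ (fun t => c * u t) < ∞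

/-- The Amemiya functional `k ↦ (1/k) (1 + I_Φ(k u))`. -/
def amemiyaFunctional {T : Type*} [MeasurableSpace T] (μ : Measure T) (Φ : T → ℝ≥0∞ → ℝ≥0∞)
    (u : T → ℝ) (k : ℝ) : ℝ≥0∞ :=
  ENNReal.ofReal (1 / k) * (1 + modular μ Φ (fun t => k * u t))

/-- The Amemiya norm `inf_{k>0} (1/k) (1 + I_Φ(k u))`. -/
def amemiyaNorm {T : Type*} [MeasurableSpace T] (μ : Measure T) (Φ : T → ℝ≥0∞ → ℝ≥0∞)
    (u : T → ℝ) : ℝ≥0∞ :=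
  ⨅ (k : ℝ) (_ : 0 < k), amemiyaFunctional μ Φ u k

/-- `K(u)`: all `k > 0` at which the infimum in the Amemiya norm is attained. -/
def amemiyaMinimizers {T : Type*} [MeasurableSpace T] (μ : Measure T) (Φ : T → ℝ≥0∞ → ℝ≥0∞)
    (u : T → ℝ) : Set ℝ :=
  {k | 0 < k ∧ amemiyaFunctional μ Φ u k = amemiyaNorm μ Φ u}

/-- The set of numbers `|∫ u v dμ|`, `v ∈ L^0`, `I_{Φ*}(v) ≤ 1`. -/
def orliczNormSet {T : Type*} [MeasurableSpace T] (μ : Measure T) (Φ : T → ℝ≥0∞ → ℝ≥0∞)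
    (u : T → ℝ) : Set ℝ :=
  {r | ∃ v : T →ₘ[μ] ℝ, modular μ (complementary Φ) v ≤ 1 ∧ r = |∫ t, u t * v t ∂μ|}

/-- The Orlicz norm `sup {|∫ u v dμ| : I_{Φ*}(v) ≤ 1}`. -/
def orliczNorm {T : Type*} [MeasurableSpace T] (μ : Measure T) (Φ : T → ℝ≥0∞ → ℝ≥0∞)
    (u : T → ℝ) : ℝ :=
  sSup (orliczNormSet μ Φ u)

/-! ### Elementary facts, needed to see that `L^Φ` is a vector space normed by the Orlicz norm -/

section Basic

variable {T : Type*} [MeasurableSpace T] {μ : Measure T}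

lemma MusielakOrliczFunction.star (Φ : MusielakOrliczFunction μ) :
    ∀ᵐ t ∂μ, ∀ (c : ℝ≥0) (x : ℝ≥0∞), c ≤ 1 → Φ.toFun t (c * x) ≤ c * Φ.toFun t x := by
  filter_upwards [Φ.convexOn, Φ.map_zero] with t h h0 c x hc
  have := h.2 (mem_univ x) (mem_univ 0) (zero_le : 0 ≤ c) (zero_le : 0 ≤ 1 - c)
    (add_tsub_cancel_of_le hc)
  simpa [h0, ENNReal.smul_def] using this

lemma MusielakOrliczFunction.mono (Φ : MusielakOrliczFunction μ) :
    ∀ᵐ t ∂μ, Monotone (Φ.toFun t) := by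
  filter_upwards [Φ.star, Φ.map_top] with t h ht x y hxy
  rcases eq_or_ne y ∞ with rfl | hy
  · simp [ht]
  lift y to ℝ≥0 using hy
  lift x to ℝ≥0 using ne_top_of_le_ne_top ENNReal.coe_ne_top hxy
  have hxy' : x ≤ y := by exact_mod_cast hxy
  rcases eq_or_ne y 0 with rfl | hy0
  · have : x = 0 := le_antisymm hxy' zero_le
    simp [this]
  have hc : x / y ≤ 1 := div_le_one_of_le₀ hxy' zero_le
  have := h (x / y) y hc
  rw [← ENNReal.coe_mul, div_mul_cancel₀ _ hy0] at this
  exact this.trans (mul_le_of_le_one_left zero_le (by exact_mod_cast hc))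

lemma modular_congr {Ψ : T → ℝ≥0∞ → ℝ≥0∞} {u w : T → ℝ} (h : u =ᵐ[μ] w) :
    modular μ Ψ u = modular μ Ψ w :=
  lintegral_congr_ae (h.mono fun t ht => by simp only [ht])

lemma MemMusielakOrlicz.congr {Ψ : T → ℝ≥0∞ → ℝ≥0∞} {u w : T → ℝ} (h : u =ᵐ[μ] w)
    (hu : MemMusielakOrlicz μ Ψ u) : MemMusielakOrlicz μ Ψ w := by
  obtain ⟨c, hc, hI⟩ := hu
  refine ⟨c, hc, ?_⟩
  have : (fun t => c * u t) =ᵐ[μ] fun t => c * w t := h.mono fun t ht => by simp only [ht]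
  rwa [← modular_congr this]

lemma MusielakOrliczFunction.mem_add (Φ : MusielakOrliczFunction μ) {u w : T →ₘ[μ] ℝ}
    (hu : MemMusielakOrlicz μ Φ.toFun u) (hw : MemMusielakOrlicz μ Φ.toFun w) :
    MemMusielakOrlicz μ Φ.toFun (u + w : T →ₘ[μ] ℝ) := by
  obtain ⟨c, hc, hu⟩ := hu
  obtain ⟨d, hd, hw⟩ := hw
  refine MemMusielakOrlicz.congr (AEEqFun.coeFn_add u w).symm ?_
  have hm : 0 < min c d := lt_min hc hd
  refine ⟨min c d / 2, by positivity, ?_⟩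
  have key : ∀ a b k : ℝ, min c d ≤ k → |b| ≤ |a| →
      ‖min c d / 2 * (a + b)‖ₑ ≤ ‖k * a‖ₑ := by
    intro a b k hk hab
    rw [enorm_le_iff_norm_le, Real.norm_eq_abs, Real.norm_eq_abs, abs_mul, abs_mul,
      abs_of_pos (by positivity : 0 < min c d / 2), abs_of_pos (hm.trans_le hk)]
    have h1 := abs_add_le a b
    nlinarith [abs_nonneg a]
  have hsm : MeasurableSet {t | |w t| ≤ |u t|} := measurableSet_le w.measurable.abs u.measurable.abs
  rw [modular, ← lintegral_add_compl _ hsm, ENNReal.add_lt_top]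
  constructor
  · refine lt_of_le_of_lt (le_trans (setLIntegral_mono_ae' hsm ?_)
      (setLIntegral_le_lintegral _ (fun t => Φ.toFun t ‖c * u t‖ₑ))) hu
    filter_upwards [Φ.mono] with t ht hts
    exact ht (key _ _ _ (min_le_left _ _) hts)
  · refine lt_of_le_of_lt (le_trans (setLIntegral_mono_ae' hsm.compl ?_)
      (setLIntegral_le_lintegral _ (fun t => Φ.toFun t ‖d * w t‖ₑ))) hw
    filter_upwards [Φ.mono] with t ht hts
    have hts' : |u t| ≤ |w t| := (not_le.mp (show ¬ |w t| ≤ |u t| from hts)).le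
    have := key _ _ _ (min_le_right c d) hts'
    rw [add_comm (w t)] at this
    exact ht this

lemma MusielakOrliczFunction.mem_zero (Φ : MusielakOrliczFunction μ) :
    MemMusielakOrlicz μ Φ.toFun (0 : T →ₘ[μ] ℝ) := by
  refine MemMusielakOrlicz.congr AEEqFun.coeFn_zero.symm ⟨1, one_pos, ?_⟩
  have : modular μ Φ.toFun (fun t => 1 * (0 : T → ℝ) t) = 0 := by
    rw [modular, ← lintegral_zero (μ := μ)]
    refine lintegral_congr_ae ?_
    filter_upwards [Φ.map_zero] with t ht
    simp [ht]
  rw [this]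
  exact ENNReal.zero_lt_top

lemma MusielakOrliczFunction.mem_smul (Φ : MusielakOrliczFunction μ) (a : ℝ) {u : T →ₘ[μ] ℝ}
    (hu : MemMusielakOrlicz μ Φ.toFun u) :
    MemMusielakOrlicz μ Φ.toFun (a • u : T →ₘ[μ] ℝ) := by
  rcases eq_or_ne a 0 with rfl | ha
  · rw [zero_smul]
    exact Φ.mem_zero
  obtain ⟨c, hc, hu⟩ := hu
  refine MemMusielakOrlicz.congr (AEEqFun.coeFn_smul a u).symm
    ⟨c / |a|, div_pos hc (abs_pos.2 ha), lt_of_le_of_lt (le_of_eq ?_) hu⟩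
  refine lintegral_congr fun t => ?_
  have h : |c / |a| * (a • ⇑u) t| = |c * u t| := by
    have ha' : |a| ≠ 0 := abs_ne_zero.2 ha
    simp only [Pi.smul_apply, smul_eq_mul, abs_mul, abs_div, abs_abs]
    field_simp
  have h' : ‖c / |a| * (a • ⇑u) t‖ₑ = ‖c * u t‖ₑ := by
    rw [← ofReal_norm, ← ofReal_norm, Real.norm_eq_abs, Real.norm_eq_abs, h]
  simp only [h']

/-- The integrand of the modular of a Musielak--Orlicz function is measurable. -/
lemma MusielakOrliczFunction.aemeasurable_comp (Φ : MusielakOrliczFunction μ) {u : T → ℝ}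
    (hu : Measurable u) : AEMeasurable (fun t => Φ.toFun t ‖u t‖ₑ) μ := by
  have hm : Measurable fun t => ⨆ q : ℚ, indicator
      {t | ((Real.toNNReal q : ℝ≥0) : ℝ≥0∞) < ‖u t‖ₑ}
      (fun t => Φ.toFun t (Real.toNNReal q : ℝ≥0)) t :=
    Measurable.iSup fun q => (Φ.measurable _).indicator (measurableSet_lt measurable_const hu.enorm)
  refine ⟨_, hm, ?_⟩
  filter_upwards [Φ.mono, Φ.map_zero, Φ.lowerSemicontinuous] with t hmono h0 hlsc
  refine le_antisymm (le_of_forall_lt fun c hc => ?_) (iSup_le fun q => ?_)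
  · have hpos : 0 < ‖u t‖ₑ := by
      rw [pos_iff_ne_zero]
      intro h
      rw [h, h0] at hc
      exact not_lt_zero hc
    obtain ⟨l, hl, hsub⟩ := exists_Ioc_subset_of_mem_nhds (hlsc _ c hc) ⟨0, hpos⟩
    obtain ⟨q, -, hq1, hq2⟩ := ENNReal.lt_iff_exists_rat_btwn.1 hl
    refine lt_of_lt_of_le (hsub ⟨hq1, hq2.le⟩) (le_iSup_of_le q ?_)
    rw [indicator_of_mem (show t ∈ {t | ((Real.toNNReal q : ℝ≥0) : ℝ≥0∞) < ‖u t‖ₑ} from hq2)]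
  · by_cases hq : t ∈ {t | ((Real.toNNReal q : ℝ≥0) : ℝ≥0∞) < ‖u t‖ₑ}
    · rw [indicator_of_mem hq]
      exact hmono (le_of_lt hq)
    · rw [indicator_of_notMem hq]
      exact zero_le

lemma young_inequality {T : Type*} (Φ : T → ℝ≥0∞ → ℝ≥0∞) (t : T) (x : ℝ≥0) (y : ℝ≥0∞) :
    x * y ≤ Φ t x + complementary Φ t y := by
  rcases eq_or_ne x 0 with rfl | hx
  · simp
  · rw [← tsub_le_iff_left]
    exact le_iSup₂_of_le x (pos_iff_ne_zero.2 hx) le_rfl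

lemma MusielakOrliczFunction.lintegral_mul_le (Φ : MusielakOrliczFunction μ) (u v : T →ₘ[μ] ℝ)
    {c : ℝ} (hc : 0 < c) :
    ∫⁻ t, ‖u t * v t‖ₑ ∂μ ≤ ENNReal.ofReal c⁻¹ *
      (modular μ Φ.toFun (fun t => c * u t) + modular μ (complementary Φ.toFun) v) := by
  rw [modular, modular, ← lintegral_add_left' (Φ.aemeasurable_comp (u.measurable.const_mul c)),
    ← lintegral_const_mul' _ _ ENNReal.ofReal_ne_top]
  refine lintegral_mono fun t => ?_
  have h := young_inequality Φ.toFun t ‖c * u t‖₊ ‖v t‖ₑ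
  refine le_trans (le_of_eq ?_) (mul_le_mul_right h _)
  have h1 : (‖c * u t‖₊ : ℝ≥0∞) = ‖c * u t‖ₑ := rfl
  have h2 : ‖c‖ₑ = ENNReal.ofReal c := by
    rw [← ofReal_norm, Real.norm_of_nonneg hc.le]
  rw [h1, enorm_mul, enorm_mul, h2, ← mul_assoc, ← mul_assoc, ← ENNReal.ofReal_mul (by positivity),
    inv_mul_cancel₀ hc.ne', ENNReal.ofReal_one, one_mul]

lemma MusielakOrliczFunction.integrable_mul (Φ : MusielakOrliczFunction μ) {u v : T →ₘ[μ] ℝ}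
    (hu : MemMusielakOrlicz μ Φ.toFun u) (hv : modular μ (complementary Φ.toFun) v ≤ 1) :
    Integrable (fun t => u t * v t) μ := by
  obtain ⟨c, hc, hu⟩ := hu
  refine ⟨u.aestronglyMeasurable.mul v.aestronglyMeasurable,
    (Φ.lintegral_mul_le u v hc).trans_lt (ENNReal.mul_lt_top ENNReal.ofReal_lt_top ?_)⟩
  exact ENNReal.add_lt_top.2 ⟨hu, hv.trans_lt ENNReal.one_lt_top⟩

lemma MusielakOrliczFunction.bddAbove_orliczNormSet (Φ : MusielakOrliczFunction μ)
    {u : T →ₘ[μ] ℝ} (hu : MemMusielakOrlicz μ Φ.toFun u) :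
    BddAbove (orliczNormSet μ Φ.toFun u) := by
  obtain ⟨c, hc, hu'⟩ := id hu
  refine ⟨(ENNReal.ofReal c⁻¹ * (modular μ Φ.toFun (fun t => c * u t) + 1)).toReal, ?_⟩
  rintro r ⟨v, hv, rfl⟩
  have hfin : ENNReal.ofReal c⁻¹ * (modular μ Φ.toFun (fun t => c * u t) + 1) ≠ ∞ :=
    (ENNReal.mul_lt_top ENNReal.ofReal_lt_top
      (ENNReal.add_lt_top.2 ⟨hu', ENNReal.one_lt_top⟩)).ne
  rw [← Real.norm_eq_abs, ← toReal_enorm]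
  refine ENNReal.toReal_mono hfin ((enorm_integral_le_lintegral_enorm _).trans
    ((Φ.lintegral_mul_le u v hc).trans ?_))
  gcongr

lemma MusielakOrliczFunction.zero_mem_orliczNormSet (Φ : MusielakOrliczFunction μ) (u : T → ℝ) :
    0 ∈ orliczNormSet μ Φ.toFun u := by
  refine ⟨0, ?_, ?_⟩
  · rw [modular_congr (w := 0) AEEqFun.coeFn_zero, modular]
    simp [complementary]
  · rw [integral_eq_zero_of_ae, abs_zero]
    filter_upwards [AEEqFun.coeFn_zero (β := ℝ) (μ := μ)] with t ht
    simp [ht]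

lemma MusielakOrliczFunction.le_orliczNorm (Φ : MusielakOrliczFunction μ) {u v : T →ₘ[μ] ℝ}
    (hu : MemMusielakOrlicz μ Φ.toFun u) (hv : modular μ (complementary Φ.toFun) v ≤ 1) :
    |∫ t, u t * v t ∂μ| ≤ orliczNorm μ Φ.toFun u :=
  le_csSup (Φ.bddAbove_orliczNormSet hu) ⟨v, hv, rfl⟩

lemma MusielakOrliczFunction.orliczNorm_le (Φ : MusielakOrliczFunction μ) {u : T → ℝ} {C : ℝ}
    (h : ∀ v : T →ₘ[μ] ℝ, modular μ (complementary Φ.toFun) v ≤ 1 →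
      |∫ t, u t * v t ∂μ| ≤ C) : orliczNorm μ Φ.toFun u ≤ C := by
  refine csSup_le ⟨0, Φ.zero_mem_orliczNormSet u⟩ ?_
  rintro r ⟨v, hv, rfl⟩
  exact h v hv

lemma MusielakOrliczFunction.orliczNorm_nonneg (Φ : MusielakOrliczFunction μ) (u : T → ℝ) :
    0 ≤ orliczNorm μ Φ.toFun u :=
  Real.sSup_nonneg (by rintro r ⟨v, -, rfl⟩; exact abs_nonneg _)

lemma MusielakOrliczFunction.orliczNorm_add_le (Φ : MusielakOrliczFunction μ) {u w : T →ₘ[μ] ℝ}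
    (hu : MemMusielakOrlicz μ Φ.toFun u) (hw : MemMusielakOrlicz μ Φ.toFun w) :
    orliczNorm μ Φ.toFun (u + w : T →ₘ[μ] ℝ) ≤
      orliczNorm μ Φ.toFun u + orliczNorm μ Φ.toFun w := by
  refine Φ.orliczNorm_le fun v hv => ?_
  have : ∫ t, (u + w : T →ₘ[μ] ℝ) t * v t ∂μ = ∫ t, u t * v t ∂μ + ∫ t, w t * v t ∂μ := by
    rw [← integral_add (Φ.integrable_mul hu hv) (Φ.integrable_mul hw hv)]
    refine integral_congr_ae ?_
    filter_upwards [AEEqFun.coeFn_add u w] with t ht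
    rw [ht, Pi.add_apply, add_mul]
  rw [this]
  exact (abs_add_le _ _).trans (add_le_add (Φ.le_orliczNorm hu hv) (Φ.le_orliczNorm hw hv))

lemma MusielakOrliczFunction.orliczNorm_smul_le (Φ : MusielakOrliczFunction μ) (a : ℝ)
    {u : T →ₘ[μ] ℝ} (hu : MemMusielakOrlicz μ Φ.toFun u) :
    orliczNorm μ Φ.toFun (a • u : T →ₘ[μ] ℝ) ≤ |a| * orliczNorm μ Φ.toFun u := by
  refine Φ.orliczNorm_le fun v hv => ?_
  have : ∫ t, (a • u : T →ₘ[μ] ℝ) t * v t ∂μ = a * ∫ t, u t * v t ∂μ := by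
    rw [← integral_const_mul]
    refine integral_congr_ae ?_
    filter_upwards [AEEqFun.coeFn_smul a u] with t ht
    rw [ht, Pi.smul_apply, smul_eq_mul, mul_assoc]
  rw [this, abs_mul]
  exact mul_le_mul_of_nonneg_left (Φ.le_orliczNorm hu hv) (abs_nonneg a)

/-- If `Φ(t,n) ≥ 1` then `Φ*(t, δ/n) ≤ δ` for `δ ≤ 1`. -/
lemma MusielakOrliczFunction.complementary_le (Φ : MusielakOrliczFunction μ) :
    ∀ᵐ t ∂μ, ∀ (n δ : ℝ≥0), 0 < n → δ ≤ 1 → 1 ≤ Φ.toFun t n →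
      complementary Φ.toFun t ((δ / n : ℝ≥0) : ℝ≥0∞) ≤ δ := by
  filter_upwards [Φ.star] with t h n δ hn hδ h1
  refine iSup₂_le fun x hx => ?_
  rw [tsub_le_iff_left, ← ENNReal.coe_mul]
  rcases le_total x n with hxn | hxn
  · refine le_add_left (ENNReal.coe_le_coe.2 ?_)
    rw [mul_div_assoc', div_le_iff₀ hn, mul_comm δ]
    gcongr
  · refine le_add_right ?_
    have h2 := h (n / x) x (div_le_one_of_le₀ hxn zero_le)
    rw [← ENNReal.coe_mul, div_mul_cancel₀ _ hx.ne'] at h2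
    have h3 : (x / n : ℝ≥0) * (1 : ℝ≥0∞) ≤ Φ.toFun t x := by
      calc ((x / n : ℝ≥0) : ℝ≥0∞) * 1 ≤ (x / n : ℝ≥0) * ((n / x : ℝ≥0) * Φ.toFun t x) := by
            gcongr
            exact h1.trans h2
        _ = Φ.toFun t x := by
            rw [← mul_assoc, ← ENNReal.coe_mul, div_mul_div_cancel₀ hn.ne', div_self hx.ne',
              ENNReal.coe_one, one_mul]
    refine le_trans ?_ h3
    rw [mul_one]
    refine ENNReal.coe_le_coe.2 ?_
    rw [mul_div_assoc']
    gcongr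
    exact mul_le_of_le_one_right zero_le hδ

lemma MusielakOrliczFunction.eq_zero_of_orliczNorm_eq_zero [SigmaFinite μ]
    (Φ : MusielakOrliczFunction μ) {u : T →ₘ[μ] ℝ} (hu : MemMusielakOrlicz μ Φ.toFun u)
    (h : orliczNorm μ Φ.toFun u = 0) : u = 0 := by
  set A : ℕ → Set T := fun n =>
    {t | u t ≠ 0} ∩ {t | 1 ≤ Φ.toFun t ((n + 1 : ℝ≥0) : ℝ≥0∞)} ∩ spanningSets μ n with hA
  have hAm : ∀ n, MeasurableSet (A n) := fun n =>
    (((measurableSet_eq_fun u.measurable measurable_const).compl).inter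
      (measurableSet_le measurable_const (Φ.measurable _))).inter (measurableSet_spanningSets μ n)
  have hA0 : ∀ n, μ (A n) = 0 := by
    intro n
    have hfin : μ (A n) < ∞ :=
      (measure_mono inter_subset_right).trans_lt (measure_spanningSets_lt_top μ n)
    set δ : ℝ≥0 := 1 / (1 + (μ (A n)).toNNReal) with hδ
    have hδ0 : 0 < δ := by positivity
    have hδ1 : δ ≤ 1 := div_le_one_of_le₀ (by simp) zero_le
    have hn : (0 : ℝ≥0) < n + 1 := by positivity
    set k : ℝ≥0 := δ / (n + 1) with hk
    have hk0 : (0 : ℝ) < k := by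
      rw [NNReal.coe_pos]
      exact div_pos hδ0 hn
    have hvm : Measurable ((A n).indicator fun t => (SignType.sign (u t) : ℝ) * k) := by
      have hs : Measurable fun x : ℝ => (SignType.sign x : ℝ) := by
        have : (fun x : ℝ => (SignType.sign x : ℝ)) =
            fun x => if 0 < x then 1 else if x < 0 then -1 else 0 := by
          funext x
          rw [sign_apply]
          split_ifs <;> simp
        rw [this]
        exact Measurable.ite measurableSet_Ioi measurable_const
          (Measurable.ite measurableSet_Iio measurable_const measurable_const)
      exact ((hs.comp u.measurable).mul_const _).indicator (hAm n)
    set v : T →ₘ[μ] ℝ := AEEqFun.mk _ hvm.aestronglyMeasurable with hv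
    have hve : (v : T → ℝ) =ᵐ[μ] (A n).indicator fun t => (SignType.sign (u t) : ℝ) * k :=
      AEEqFun.coeFn_mk _ _
    have hv1 : modular μ (complementary Φ.toFun) v ≤ 1 := by
      rw [modular_congr hve, modular]
      calc _ ≤ ∫⁻ t, (A n).indicator (fun _ => (δ : ℝ≥0∞)) t ∂μ := by
            refine lintegral_mono_ae ?_
            filter_upwards [Φ.complementary_le] with t ht
            by_cases htA : t ∈ A n
            · rw [indicator_of_mem htA, indicator_of_mem htA]
              have hsg : ‖(SignType.sign (u t) : ℝ) * k‖ₑ = (k : ℝ≥0∞) := by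
                rw [enorm_mul]
                have h1 : ‖(k : ℝ)‖ₑ = (k : ℝ≥0∞) := by simp
                have h2 : ‖(SignType.sign (u t) : ℝ)‖ₑ = 1 := by
                  rcases lt_or_gt_of_ne htA.1.1 with h | h
                  · simp [sign_neg h]
                  · simp [sign_pos h]
                rw [h1, h2, one_mul]
              rw [hsg]
              exact ht _ _ hn hδ1 htA.1.2
            · rw [indicator_of_notMem htA, indicator_of_notMem htA]
              simp [complementary]
        _ = δ * μ (A n) := lintegral_indicator_const (hAm n) _
        _ ≤ 1 := by
            rw [← ENNReal.coe_toNNReal hfin.ne, ← ENNReal.coe_mul, ← ENNReal.coe_one,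
              ENNReal.coe_le_coe, hδ, one_div_mul_eq_div]
            exact div_le_one_of_le₀ (by simp) zero_le
    have hint := Φ.integrable_mul hu hv1
    have hz : ∫ t, u t * v t ∂μ = 0 := by
      have := Φ.le_orliczNorm hu hv1
      rw [h] at this
      exact abs_eq_zero.1 (le_antisymm this (abs_nonneg _))
    have hform : (fun t => u t * v t) =ᵐ[μ] (A n).indicator fun t => |u t| * k := by
      filter_upwards [hve] with t ht
      rw [ht]
      by_cases htA : t ∈ A n
      · rw [indicator_of_mem htA, indicator_of_mem htA, ← mul_assoc, self_mul_sign]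
      · rw [indicator_of_notMem htA, indicator_of_notMem htA, mul_zero]
    have hnn : 0 ≤ᵐ[μ] fun t => u t * v t := by
      filter_upwards [hform] with t ht
      rw [ht]
      exact indicator_nonneg (fun t _ => mul_nonneg (abs_nonneg _) hk0.le) t
    have hae := (integral_eq_zero_iff_of_nonneg_ae hnn hint).1 hz
    refine measure_mono_null ?_ (ae_iff.1 (hform.symm.trans hae))
    intro t htA
    rw [mem_ofPred_eq, indicator_of_mem htA]
    exact (mul_pos (abs_pos.2 htA.1.1) hk0).ne'
  have hall : ∀ᵐ t ∂μ, ∀ n, t ∉ A n := ae_all_iff.2 fun n => measure_eq_zero_iff_ae_notMem.1 (hA0 n)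
  refine AEEqFun.ext ?_
  filter_upwards [hall, AEEqFun.coeFn_zero (β := ℝ) (μ := μ), Φ.lowerSemicontinuous, Φ.map_top,
    Φ.mono] with t ht h0 hlsc htop hmono
  rw [h0, Pi.zero_apply]
  by_contra hne
  have hev : ∀ᶠ y in 𝓝 (∞ : ℝ≥0∞), 1 < Φ.toFun t y :=
    hlsc ∞ 1 (by simp [htop])
  obtain ⟨N, hN⟩ := (ENNReal.tendsto_nat_nhds_top.eventually hev).exists
  set M := max N (spanningSetsIndex μ t) with hM
  refine ht M ⟨⟨hne, ?_⟩, ?_⟩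
  · refine hN.le.trans (hmono ?_)
    have : (N : ℝ≥0) ≤ M + 1 := by
      have : N ≤ M + 1 := (le_max_left _ _).trans (Nat.le_succ _)
      exact_mod_cast this
    exact_mod_cast this
  · exact monotone_spanningSets μ (le_max_right _ _) (mem_spanningSetsIndex μ t)

end Basic

/-- The Musielak--Orlicz space `L^Φ`, a vector space of `μ`-a.e. classes of functions. -/
def OrliczSpace {T : Type*} [MeasurableSpace T] {μ : Measure T}
    (Φ : MusielakOrliczFunction μ) : Submodule ℝ (T →ₘ[μ] ℝ) where
  carrier := {u | MemMusielakOrlicz μ Φ.toFun u}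
  add_mem' hu hw := Φ.mem_add hu hw
  zero_mem' := Φ.mem_zero
  smul_mem' a _ hu := Φ.mem_smul a hu

/-- `L^Φ` carries the Orlicz norm, i.e. it is the space `L_0^Φ`. -/
instance OrliczSpace.instNormedAddCommGroup {T : Type*} [MeasurableSpace T] {μ : Measure T}
    [SigmaFinite μ] (Φ : MusielakOrliczFunction μ) : NormedAddCommGroup (OrliczSpace Φ) :=
  AddGroupNorm.toNormedAddCommGroup
    { toFun := fun u => orliczNorm μ Φ.toFun (u : T →ₘ[μ] ℝ)
      map_zero' := by
        have := Φ.orliczNorm_smul_le 0 Φ.mem_zero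
        rw [zero_smul, abs_zero, zero_mul] at this
        exact le_antisymm this (Φ.orliczNorm_nonneg _)
      add_le' := fun u w => Φ.orliczNorm_add_le u.2 w.2
      neg' := fun u => by
        have h : ∀ w : OrliczSpace Φ, orliczNorm μ Φ.toFun ((-w : OrliczSpace Φ) : T →ₘ[μ] ℝ) ≤
            orliczNorm μ Φ.toFun (w : T →ₘ[μ] ℝ) := fun w => by
          have := Φ.orliczNorm_smul_le (-1) w.2
          simpa using this
        refine le_antisymm (h u) ?_
        have := h (-u)
        rwa [neg_neg] at this
      eq_zero_of_map_eq_zero' := fun u hu =>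
        Subtype.ext (Φ.eq_zero_of_orliczNorm_eq_zero u.2 hu) }

instance OrliczSpace.instNormedSpace {T : Type*} [MeasurableSpace T] {μ : Measure T}
    [SigmaFinite μ] (Φ : MusielakOrliczFunction μ) : NormedSpace ℝ (OrliczSpace Φ) where
  norm_smul_le a u := Φ.orliczNorm_smul_le a u.2

lemma OrliczSpace.norm_def {T : Type*} [MeasurableSpace T] {μ : Measure T}
    [SigmaFinite μ] (Φ : MusielakOrliczFunction μ) (u : OrliczSpace Φ) :
    ‖u‖ = orliczNorm μ Φ.toFun (u : T →ₘ[μ] ℝ) := rfl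

/-- `0 ≤ u_n ↑ u` in `L^Φ`. -/
def IncreasesTo {T : Type*} [MeasurableSpace T] {μ : Measure T} {Φ : MusielakOrliczFunction μ}
    (w : ℕ → OrliczSpace Φ) (u : OrliczSpace Φ) : Prop :=
  (∀ n, 0 ≤ (w n : T →ₘ[μ] ℝ)) ∧ Monotone (fun n => (w n : T →ₘ[μ] ℝ)) ∧
    ∀ᵐ t ∂μ, Tendsto (fun n => (w n : T →ₘ[μ] ℝ) t) atTop (𝓝 ((u : T →ₘ[μ] ℝ) t))

/-- The positive part `f⁺(u) = sup {f(w) : 0 ≤ w ≤ u}` of a functional, on the functions `u ≥ 0`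
in `L^Φ`. -/
def functionalPosPart {T : Type*} [MeasurableSpace T] {μ : Measure T} [SigmaFinite μ]
    {Φ : MusielakOrliczFunction μ} (f : StrongDual ℝ (OrliczSpace Φ)) (u : OrliczSpace Φ) : ℝ :=
  sSup {r | ∃ w : OrliczSpace Φ, 0 ≤ (w : T →ₘ[μ] ℝ) ∧ (w : T →ₘ[μ] ℝ) ≤ u ∧ r = f w}

/-- The order continuous component `F_c(u) = inf {sup_n F(u_n) : 0 ≤ u_n ↑ u}` of a positive
functional `F`, on the functions `u ≥ 0` in `L^Φ`. -/
def positiveOrderContinuousPart {T : Type*} [MeasurableSpace T] {μ : Measure T}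
    {Φ : MusielakOrliczFunction μ} (F : OrliczSpace Φ → ℝ) (u : OrliczSpace Φ) : ℝ :=
  sInf {r | ∃ w : ℕ → OrliczSpace Φ, IncreasesTo w u ∧ r = ⨆ n, F (w n)}

/-- The order continuous component `f_c = (f⁺)_c - (f⁻)_c`, `f⁻ = (-f)⁺`, of a functional `f`,
on the functions `u ≥ 0` in `L^Φ` (which determine it). -/
def orderContinuousPart {T : Type*} [MeasurableSpace T] {μ : Measure T} [SigmaFinite μ]
    {Φ : MusielakOrliczFunction μ} (f : StrongDual ℝ (OrliczSpace Φ)) (u : OrliczSpace Φ) : ℝ :=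
  positiveOrderContinuousPart (functionalPosPart f) u -
    positiveOrderContinuousPart (functionalPosPart (-f)) u

/-- A functional is purely singular if its order continuous component is zero. -/
def IsPurelySingular {T : Type*} [MeasurableSpace T] {μ : Measure T} [SigmaFinite μ]
    {Φ : MusielakOrliczFunction μ} (f : StrongDual ℝ (OrliczSpace Φ)) : Prop :=
  ∀ u : OrliczSpace Φ, 0 ≤ (u : T →ₘ[μ] ℝ) → orderContinuousPart f u = 0

/-- A support functional at `x`: a norm-one functional with `f(x) = ‖x‖`. -/
def IsSupportFunctional {X : Type*} [NormedAddCommGroup X] [NormedSpace ℝ X]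
    (f : StrongDual ℝ X) (x : X) : Prop :=
  ‖f‖ = 1 ∧ f x = ‖x‖

end

/-! If `K(u)` is empty, the infimum in the Amemiya norm A of `u` is approached only as k → ∞. Since
I_Φ(ku)/k increases with k, it never exceeds A. Two things follow. Every multiple of `u` has finite
modular, so a purely singular functional vanishes at `u` and f(u) = ∫ uv. By monotone convergence, ∫
sup_n Φ(t,n|u|)/n ≤ A; and Young's inequality bounds this recession function below by |u| b_{Φ*}. As
A is at most the Orlicz norm, ∫ |u| b_{Φ*} ≤ ‖u‖. Conversely, any competitor v in the Orlicz norm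
satisfies |v| ≤ b_{Φ*} a.e. So, given (i), f(u) = ‖u‖ means exactly that uv = |u| b_{Φ*} a.e., which
is (ii).

Condition (i) describes the dual unit ball: ‖f‖ ≤ 1 iff I_{Φ*}(v) + ‖f_s‖ ≤ 1
(`norm_le_one_of_modular_add_le`, `modular_add_le_of_norm_le_one`). Sufficiency is Young's
inequality together with |f_s(x)| ≤ ‖f_s‖ whenever I_Φ(x) < ∞. For necessity, an almost optimal test
function for I_{Φ*}(v) is glued to an almost maximizer of f_s of tiny modular: f_s does not see the
former, and ∫ · v hardly sees the latter.

Both parts need the hard half of the Amemiya formula, inf_k (1 + I_Φ(ku))/k ≤ ‖u‖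
(`exists_one_add_modular_le`). It is Lagrange duality for maximizing ∫ v|u| under I_{Φ*}(v) ≤ 1,
with I_Φ recovered from I_{Φ*} by biconjugation and measurable selection. -/

/-! ### Complementary functions and biconjugation. -/

section Complementary

variable {T : Type*}

lemma complementary_mono (Ψ : T → ℝ≥0∞ → ℝ≥0∞) (t : T) : Monotone (complementary Ψ t) := by
  intro y z h
  unfold complementary
  gcongr

lemma complementary_zero (Ψ : T → ℝ≥0∞ → ℝ≥0∞) (t : T) : complementary Ψ t 0 = 0 := by
  simp [complementary]

/-- A weighted sum of two Young inequalities with the same x; no property of `Ψ` is needed, as for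
any supremum of affine functions. -/
lemma complementary_convex (Ψ : T → ℝ≥0∞ → ℝ≥0∞) (t : T) {a b : ℝ≥0} (hab : a + b = 1)
    (y z : ℝ≥0∞) : complementary Ψ t (a * y + b * z) ≤
      a * complementary Ψ t y + b * complementary Ψ t z := by
  refine iSup₂_le fun x _ => ?_
  rw [tsub_le_iff_left]
  have h1 := mul_le_mul_right (young_inequality Ψ t x y) (a : ℝ≥0∞)
  have h2 := mul_le_mul_right (young_inequality Ψ t x z) (b : ℝ≥0∞)
  have hΨ : Ψ t x = a * Ψ t x + b * Ψ t x := by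
    rw [← add_mul, ← ENNReal.coe_add, hab, ENNReal.coe_one, one_mul]
  calc (x : ℝ≥0∞) * (a * y + b * z) = a * (x * y) + b * (x * z) := by ring
    _ ≤ a * (Ψ t x + complementary Ψ t y) + b * (Ψ t x + complementary Ψ t z) := add_le_add h1 h2
    _ = (a * Ψ t x + b * Ψ t x) + (a * complementary Ψ t y + b * complementary Ψ t z) := by ring
    _ = _ := by rw [← hΨ]

/-- For finite arguments the supremum in the complementary function may be taken over a countable
dense set. -/
lemma complementary_eq_iSup_denseSeq {Ψ : T → ℝ≥0∞ → ℝ≥0∞} {t : T} (h : Monotone (Ψ t))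
    (y : ℝ≥0) : complementary Ψ t y =
      ⨆ n, ((TopologicalSpace.denseSeq ℝ≥0 n : ℝ≥0) * (y : ℝ≥0∞) -
        Ψ t (TopologicalSpace.denseSeq ℝ≥0 n : ℝ≥0)) := by
  refine le_antisymm (iSup₂_le fun x hx => le_of_forall_lt fun c hc => ?_)
    (iSup_le fun n => ?_)
  · rw [lt_tsub_iff_right] at hc
    have hfin : c + Ψ t x ≠ ∞ := hc.ne_top
    obtain ⟨hc', hx'⟩ := ENNReal.add_ne_top.1 hfin
    set d := (c + Ψ t x).toNNReal with hd
    have hd' : (d : ℝ≥0∞) = c + Ψ t x := ENNReal.coe_toNNReal hfin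
    rw [← hd', ← ENNReal.coe_mul, ENNReal.coe_lt_coe] at hc
    have hy : 0 < y := by
      rw [pos_iff_ne_zero]
      rintro rfl
      simp at hc
    have h1 : d / y < x := by rwa [div_lt_iff₀ hy]
    obtain ⟨n, hn1, hn2⟩ := (TopologicalSpace.denseRange_denseSeq ℝ≥0).exists_mem_open
      isOpen_Ioo (exists_between h1)
    refine lt_of_lt_of_le ?_ (le_iSup _ n)
    rw [lt_tsub_iff_right]
    have h2 : c + Ψ t (TopologicalSpace.denseSeq ℝ≥0 n : ℝ≥0) ≤ d := by
      rw [hd']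
      gcongr
      exact h (by exact_mod_cast hn2.le)
    refine h2.trans_lt ?_
    rw [← ENNReal.coe_mul, ENNReal.coe_lt_coe]
    rwa [div_lt_iff₀ hy] at hn1
  · rw [tsub_le_iff_left]
    exact young_inequality Ψ t _ _

/-- The Fenchel--Moreau inequality `φ ≤ φ**` for convex functions on `[0,∞]`. -/
lemma le_complementary_complementary {Φ : T → ℝ≥0∞ → ℝ≥0∞} {t : T}
    (hconv : ConvexOn ℝ≥0 univ (Φ t)) (hlsc : LowerSemicontinuous (Φ t)) (hmono : Monotone (Φ t))
    (h0 : Φ t 0 = 0) (x₀ : ℝ≥0) : Φ t x₀ ≤ complementary (complementary Φ) t x₀ := by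
  refine le_of_forall_lt_imp_le_of_dense fun c hc => ?_
  lift c to ℝ≥0 using hc.ne_top
  rcases eq_or_ne c 0 with rfl | hc0
  · simp
  have hx₀ : 0 < x₀ := by
    rw [pos_iff_ne_zero]
    rintro rfl
    simp [h0] at hc
  -- Lower semicontinuity keeps Φ(t,·) above c just to the left of x₀; this is what makes the slope
  -- `y` below finite.
  obtain ⟨l, hl, hsub⟩ := exists_Ioc_subset_of_mem_nhds (hlsc _ _ hc)
    ⟨0, ENNReal.coe_pos.2 hx₀⟩
  obtain ⟨x₁, hx₁, hx₁'⟩ := ENNReal.lt_iff_exists_nnreal_btwn.1 hl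
  have hx₁0 : x₁ < x₀ := by exact_mod_cast hx₁'
  have hsep : ∀ x : ℝ≥0, x₁ < x → x < x₀ → (c : ℝ≥0∞) < Φ t x := fun x h1 h2 =>
    hsub ⟨hx₁.trans (by exact_mod_cast h1), by exact_mod_cast h2.le⟩
  -- The slope of a line through (x₀, c) lying below the graph: the supremum of the slopes,
  -- truncated at 0, of chords from points of the graph left of x₀.
  set y : ℝ≥0∞ := ⨆ (x : ℝ≥0) (_ : x < x₀), ((c : ℝ≥0∞) - Φ t x) / ((x₀ - x : ℝ≥0) : ℝ≥0∞)
    with hy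
  have hytop : y ≤ (c : ℝ≥0∞) / ((x₀ - x₁ : ℝ≥0) : ℝ≥0∞) := by
    refine iSup₂_le fun x hx => ?_
    rcases le_or_gt x x₁ with h | h
    · refine ENNReal.div_le_div tsub_le_self ?_
      exact ENNReal.coe_le_coe.2 (tsub_le_tsub_left h _)
    · rw [tsub_eq_zero_of_le (hsep x h hx).le]
      simp
  have hyt : y ≠ ∞ := ne_top_of_le_ne_top (ENNReal.div_ne_top ENNReal.coe_ne_top
    (ENNReal.coe_ne_zero.2 (tsub_pos_of_lt hx₁0).ne')) hytop
  have hlow : ∀ x : ℝ≥0, x < x₀ → (c : ℝ≥0∞) ≤ Φ t x + (x₀ - x : ℝ≥0) * y := by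
    intro x hx
    have h1 : ((c : ℝ≥0∞) - Φ t x) / ((x₀ - x : ℝ≥0) : ℝ≥0∞) ≤ y :=
      le_iSup₂ (f := fun (x : ℝ≥0) (_ : x < x₀) =>
        ((c : ℝ≥0∞) - Φ t x) / ((x₀ - x : ℝ≥0) : ℝ≥0∞)) x hx
    rw [ENNReal.div_le_iff (ENNReal.coe_ne_zero.2 (tsub_pos_of_lt hx).ne') ENNReal.coe_ne_top,
      tsub_le_iff_left, mul_comm] at h1
    exact h1
  -- By convexity, and since c lies below the graph at x₀, chords from the left have slope at most
  -- that of any chord to the right.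
  have hup : ∀ x : ℝ≥0, x₀ < x → (c : ℝ≥0∞) + (x - x₀ : ℝ≥0) * y ≤ Φ t x := by
    intro x hx
    rcases eq_or_ne (Φ t x) ∞ with htop | hfin
    · simp [htop]
    have hcx : (c : ℝ≥0∞) ≤ Φ t x := hc.le.trans (hmono (by exact_mod_cast hx.le))
    have hdx : ((x - x₀ : ℝ≥0) : ℝ≥0∞) ≠ 0 := ENNReal.coe_ne_zero.2 (tsub_pos_of_lt hx).ne'
    suffices h : y ≤ (Φ t x - c) / ((x - x₀ : ℝ≥0) : ℝ≥0∞) by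
      rw [ENNReal.le_div_iff_mul_le (Or.inl hdx) (Or.inl ENNReal.coe_ne_top)] at h
      rw [mul_comm]
      exact (add_le_add_right h _).trans (add_tsub_cancel_of_le hcx).le
    refine iSup₂_le fun x' hx' => ?_
    rcases le_total (c : ℝ≥0∞) (Φ t x') with h | h
    · simp [tsub_eq_zero_of_le h]
    have hfin' : Φ t x' ≠ ∞ := ne_top_of_le_ne_top ENNReal.coe_ne_top h
    have hx'x : x' < x := hx'.trans hx
    have hD : x - x' ≠ 0 := (tsub_pos_of_lt hx'x).ne'
    have hsum : (x - x₀) / (x - x') + (x₀ - x') / (x - x') = 1 := by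
      rw [← add_div, tsub_add_tsub_cancel hx.le hx'.le, div_self hD]
    have hcv := hconv.2 (mem_univ (x' : ℝ≥0∞)) (mem_univ (x : ℝ≥0∞)) zero_le zero_le hsum
    have hpt : ((x - x₀) / (x - x')) * x' + ((x₀ - x') / (x - x')) * x = x₀ := by
      rw [div_mul_eq_mul_div, div_mul_eq_mul_div, ← add_div, div_eq_iff hD]
      apply NNReal.coe_injective
      push_cast [NNReal.coe_sub hx.le, NNReal.coe_sub hx'.le, NNReal.coe_sub hx'x.le]
      ring
    simp only [ENNReal.smul_def, smul_eq_mul] at hcv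
    rw [← ENNReal.coe_mul, ← ENNReal.coe_mul, ← ENNReal.coe_add, hpt] at hcv
    have hcv' := hc.le.trans hcv
    generalize hA : Φ t x = A at hcv' hfin hcx ⊢
    generalize hB : Φ t x' = B at hcv' hfin' h ⊢
    lift A to ℝ≥0 using hfin
    lift B to ℝ≥0 using hfin'
    rw [ENNReal.div_le_iff (ENNReal.coe_ne_zero.2 (tsub_pos_of_lt hx').ne') ENNReal.coe_ne_top,
      mul_comm, ← mul_div_assoc, ENNReal.le_div_iff_mul_le (Or.inl hdx) (Or.inl ENNReal.coe_ne_top)]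
    norm_cast at hcv' hcx h ⊢
    rw [← NNReal.coe_le_coe] at hcv' ⊢
    push_cast [NNReal.coe_sub hx.le, NNReal.coe_sub hx'.le, NNReal.coe_sub hx'x.le,
      NNReal.coe_sub hcx, NNReal.coe_sub h] at hcv' ⊢
    have hD' : (0 : ℝ) < x - x' := sub_pos.2 (by exact_mod_cast hx'x)
    rw [div_mul_eq_mul_div, div_mul_eq_mul_div, ← add_div, le_div_iff₀ hD'] at hcv'
    nlinarith
  have hline : ∀ x : ℝ≥0, (c : ℝ≥0∞) + x * y ≤ Φ t x + x₀ * y := by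
    intro x
    rcases lt_trichotomy x x₀ with h | rfl | h
    · calc (c : ℝ≥0∞) + x * y ≤ Φ t x + (x₀ - x : ℝ≥0) * y + x * y := by gcongr; exact hlow x h
        _ = Φ t x + x₀ * y := by
          rw [add_assoc, ← add_mul, ← ENNReal.coe_add, tsub_add_cancel_of_le h.le]
    · gcongr
    · calc (c : ℝ≥0∞) + x * y = c + (x - x₀ : ℝ≥0) * y + x₀ * y := by
            rw [add_assoc, ← add_mul, ← ENNReal.coe_add, tsub_add_cancel_of_le h.le]
        _ ≤ Φ t x + x₀ * y := by gcongr; exact hup x h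
  have hcy : (c : ℝ≥0∞) ≤ x₀ * y := by simpa [h0] using hline 0
  have hy0 : y ≠ 0 := by
    intro h
    rw [h, mul_zero] at hcy
    exact hc0 (by simpa using hcy)
  -- The supporting line says Φ*(y) ≤ x₀y − c, so y is a witness for Φ**(x₀) ≥ c.
  have hconj : complementary Φ t y ≤ x₀ * y - c := by
    refine iSup₂_le fun x _ => ?_
    have h1 := hline x
    refine ENNReal.le_sub_of_add_le_left ENNReal.coe_ne_top ?_
    rcases le_total ((x : ℝ≥0∞) * y) (Φ t x) with h | h
    · rw [tsub_eq_zero_of_le h, add_zero]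
      exact hcy
    · have hfin : Φ t x ≠ ∞ := ne_top_of_le_ne_top (ENNReal.mul_ne_top ENNReal.coe_ne_top hyt) h
      rw [← ENNReal.add_le_add_iff_left hfin, ← add_assoc, add_comm (Φ t x), add_assoc,
        add_tsub_cancel_of_le h]
      exact h1
  clear_value y
  lift y to ℝ≥0 using hyt
  refine le_trans ?_ (le_iSup₂ (f := fun (z : ℝ≥0) (_ : 0 < z) =>
    (z : ℝ≥0∞) * x₀ - complementary Φ t z) y (pos_iff_ne_zero.2 (by simpa using hy0)))
  have h2 : (c : ℝ≥0∞) = x₀ * y - (x₀ * y - c) :=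
    (ENNReal.sub_sub_cancel (ENNReal.mul_ne_top ENNReal.coe_ne_top ENNReal.coe_ne_top) hcy).symm
  calc (c : ℝ≥0∞) = x₀ * y - (x₀ * y - c) := h2
    _ ≤ y * x₀ - complementary Φ t y := by
      rw [mul_comm (y : ℝ≥0∞)]
      exact tsub_le_tsub_left hconj _

end Complementary

/-! ### Measurable selection: exchanging integral and supremum. -/

section Selection

variable {T : Type*} [MeasurableSpace T] {μ : Measure T}

lemma aemeasurable_complementary {Ψ : T → ℝ≥0∞ → ℝ≥0∞} (hmono : ∀ᵐ t ∂μ, Monotone (Ψ t))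
    (hm : ∀ x : ℝ≥0, AEMeasurable (fun t => Ψ t x) μ) {y : T → ℝ≥0} (hy : Measurable y) :
    AEMeasurable (fun t => complementary Ψ t (y t)) μ := by
  refine AEMeasurable.congr (f := fun t => ⨆ n, ((TopologicalSpace.denseSeq ℝ≥0 n : ℝ≥0) *
    (y t : ℝ≥0∞) - Ψ t (TopologicalSpace.denseSeq ℝ≥0 n : ℝ≥0))) ?_ ?_
  · exact AEMeasurable.iSup fun n =>
      ((hy.coe_nnreal_ennreal.const_mul _).aemeasurable).sub (hm _)
  · filter_upwards [hmono] with t ht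
    exact (complementary_eq_iSup_denseSeq ht (y t)).symm

/-- Measurable selection of almost maximizers among finitely many arguments. -/
lemma exists_measurable_maximizer {Ψ : T → ℝ≥0∞ → ℝ≥0∞} (h0 : ∀ᵐ t ∂μ, Ψ t 0 = 0)
    {y : T → ℝ≥0} (hy : Measurable y) (q : ℕ → ℝ≥0) (a : ℕ → T → ℝ≥0∞)
    (ha : ∀ n, Measurable (a n)) (hae : ∀ n, ∀ᵐ t ∂μ, Ψ t (q n) = a n t) (n : ℕ) :
    ∃ (w : T → ℝ≥0) (g : T → ℝ≥0∞) (C : ℝ≥0), Measurable w ∧ Measurable g ∧ (∀ t, w t ≤ C) ∧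
      (∀ᵐ t ∂μ, Ψ t (w t) = g t) ∧ (∀ t, g t ≤ w t * y t) ∧
      ∀ i < n, ∀ t, q i * y t - a i t ≤ w t * y t - g t := by
  induction n with
  | zero =>
    refine ⟨0, 0, 0, measurable_const, measurable_const, by simp, ?_, by simp, by simp⟩
    filter_upwards [h0] with t ht
    simp [ht]
  | succ n ih =>
    obtain ⟨w, g, C, hw, hg, hC, hwg, hgy, hmax⟩ := ih
    -- Where the new candidate is strictly better it replaces the old one. Its truncated difference
    -- is then positive, which preserves `g ≤ w * y`.
    set D : Set T := {t | w t * y t - g t < q n * y t - a n t} with hD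
    have hyc := hy.coe_nnreal_ennreal
    have hDm : MeasurableSet D := measurableSet_lt
      ((hw.coe_nnreal_ennreal.mul hyc).sub hg) ((hyc.const_mul _).sub (ha n))
    classical
    refine ⟨D.piecewise (fun _ => q n) w, D.piecewise (a n) g, max C (q n),
      Measurable.piecewise hDm measurable_const hw, Measurable.piecewise hDm (ha n) hg,
      fun t => ?_, ?_, fun t => ?_, fun i hi t => ?_⟩
    · by_cases ht : t ∈ D
      · simp [ht]
      · simp [ht, hC t]
    · filter_upwards [hwg, hae n] with t h1 h2
      by_cases ht : t ∈ D
      · simp [ht, h2]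
      · simp [ht, h1]
    · by_cases ht : t ∈ D
      · simp only [ht, piecewise_eq_of_mem]
        by_contra! hlt
        have h1 : w t * y t - g t < q n * y t - a n t := ht
        rw [tsub_eq_zero_of_le hlt.le] at h1
        exact not_lt_zero h1
      · simp [ht, hgy t]
    · rcases Nat.lt_succ_iff_lt_or_eq.1 hi with hi | rfl
      · by_cases ht : t ∈ D
        · simp only [ht, piecewise_eq_of_mem]
          exact (hmax i hi t).trans (le_of_lt ht)
        · simpa [ht] using hmax i hi t
      · by_cases ht : t ∈ D
        · simp [ht]
        · simpa [ht] using not_lt.1 (show ¬ (w t * y t - g t < q i * y t - a i t) from ht)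

/-- Every number below the modular of the complementary function is exceeded by
`∫ w y - ∫ Ψ(t, w)` for a suitable measurable `w ≥ 0`. -/
lemma exists_lt_of_lt_lintegral_complementary [SigmaFinite μ] {Ψ : T → ℝ≥0∞ → ℝ≥0∞}
    (h0 : ∀ᵐ t ∂μ, Ψ t 0 = 0) (hmono : ∀ᵐ t ∂μ, Monotone (Ψ t))
    (hm : ∀ x : ℝ≥0, AEMeasurable (fun t => Ψ t x) μ) {y : T → ℝ≥0} (hy : Measurable y)
    {c : ℝ≥0∞} (hc : c < ∫⁻ t, complementary Ψ t (y t) ∂μ) :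
    ∃ w : T → ℝ≥0, Measurable w ∧ ∫⁻ t, w t * y t ∂μ < ∞ ∧
      c + ∫⁻ t, Ψ t (w t) ∂μ < ∫⁻ t, w t * y t ∂μ := by
  set q := TopologicalSpace.denseSeq ℝ≥0 with hq
  set a : ℕ → T → ℝ≥0∞ := fun n => (hm (q n)).mk with ha_def
  have ha : ∀ n, Measurable (a n) := fun n => (hm (q n)).measurable_mk
  have hae : ∀ n, ∀ᵐ t ∂μ, Ψ t (q n) = a n t := fun n => (hm (q n)).ae_eq_mk
  have hyc := hy.coe_nnreal_ennreal
  -- On S n the measure is finite and y is bounded. As the selected w is bounded too, ∫ w y is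
  -- finite there and integrals can be subtracted.
  set S : ℕ → Set T := fun n => spanningSets μ n ∩ {t | y t ≤ n} with hS
  have hSm : ∀ n, MeasurableSet (S n) := fun n =>
    (measurableSet_spanningSets μ n).inter (measurableSet_le hy measurable_const)
  have hSmono : Monotone S := fun m n hmn => inter_subset_inter (monotone_spanningSets μ hmn)
    fun t (ht : y t ≤ m) => ht.trans (by exact_mod_cast hmn)
  set F : ℕ → T → ℝ≥0∞ := fun n => (S n).indicator
    fun t => ⨆ i, ⨆ (_ : i < n), (q i * y t - a i t) with hF
  have hFm : ∀ n, Measurable (F n) := fun n => Measurable.indicator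
    (Measurable.iSup fun i => Measurable.iSup fun _ => (hyc.const_mul _).sub (ha i)) (hSm n)
  have hFmono : Monotone F := by
    intro m n hmn t
    refine (indicator_le_indicator_of_subset (hSmono hmn) (fun _ => zero_le) t).trans ?_
    refine indicator_le_indicator ?_
    exact iSup_mono fun i => iSup_mono' fun hi => ⟨hi.trans_le hmn, le_rfl⟩
  have hle : ∫⁻ t, complementary Ψ t (y t) ∂μ ≤ ∫⁻ t, ⨆ n, F n t ∂μ := by
    refine lintegral_mono_ae ?_
    filter_upwards [hmono, ae_all_iff.2 hae] with t h1 h2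
    rw [complementary_eq_iSup_denseSeq h1]
    refine iSup_le fun i => ?_
    obtain ⟨N, hN⟩ := exists_nat_ge (y t)
    set M := max (max N (spanningSetsIndex μ t)) (i + 1) with hM
    have htM : t ∈ S M := ⟨monotone_spanningSets μ ((le_max_right _ _).trans (le_max_left _ _))
      (mem_spanningSetsIndex μ t), hN.trans
        (by exact_mod_cast (le_max_left _ _).trans (le_max_left _ _))⟩
    refine le_iSup_of_le M ?_
    simp only [hF, indicator_of_mem htM]
    refine le_iSup₂_of_le i ((Nat.lt_succ_self i).trans_le (le_max_right _ _)) ?_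
    rw [← hq, h2 i]
  rw [lintegral_iSup hFm hFmono] at hle
  obtain ⟨n, hn⟩ := lt_iSup_iff.1 (hc.trans_le hle)
  obtain ⟨w, g, C, hw, hg, hC, hwg, hgy, hmax⟩ := exists_measurable_maximizer h0 hy q a ha hae n
  refine ⟨(S n).indicator w, hw.indicator (hSm n), ?_⟩
  have hwy : ∫⁻ t, ((S n).indicator w t : ℝ≥0) * (y t : ℝ≥0∞) ∂μ = ∫⁻ t in S n, w t * y t ∂μ := by
    rw [← lintegral_indicator (hSm n)]
    refine lintegral_congr fun t => ?_
    by_cases ht : t ∈ S n <;> simp [ht]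
  have hΨw : ∫⁻ t, Ψ t ((S n).indicator w t : ℝ≥0) ∂μ = ∫⁻ t in S n, g t ∂μ := by
    rw [← lintegral_indicator (hSm n)]
    refine lintegral_congr_ae ?_
    filter_upwards [hwg, h0] with t h1 h2
    by_cases ht : t ∈ S n
    · simp [ht, h1]
    · simp [ht, h2]
  have hfin : ∫⁻ t in S n, w t * y t ∂μ < ∞ := by
    refine lt_of_le_of_lt (setLIntegral_mono (g := fun _ => (C : ℝ≥0∞) * (n : ℝ≥0))
      measurable_const fun t ht => ?_) ?_
    · gcongr
      · exact hC t
      · exact ht.2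
    · rw [setLIntegral_const]
      exact ENNReal.mul_lt_top (ENNReal.mul_lt_top ENNReal.coe_lt_top ENNReal.coe_lt_top)
        ((measure_mono inter_subset_left).trans_lt (measure_spanningSets_lt_top μ n))
  rw [hwy, hΨw]
  refine ⟨hfin, ?_⟩
  have hgfin : ∫⁻ t in S n, g t ∂μ ≠ ∞ := ((lintegral_mono fun t => hgy t).trans_lt hfin).ne
  rw [← lt_tsub_iff_right, ← lintegral_sub hg hgfin (Eventually.of_forall hgy)]
  refine hn.trans_le ?_
  rw [hF, lintegral_indicator (hSm n)]
  exact lintegral_mono fun t => iSup₂_le fun i hi => hmax i hi t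

end Selection

/-! ### The hard half of the Amemiya formula. -/

/-- The Lagrange multiplier: points of S are pairs (cost, value), and H bounds the value at cost at
most 1. By `hconv`, slopes from (1, H) to points on the right lie below those to points on the left,
so the supremum of the former is the slope of a majorizing line. Including 0 among the slopes makes
it nonnegative. -/
lemma exists_multiplier {S : Set (ℝ × ℝ)} {H : ℝ} (h0 : (0, 0) ∈ S)
    (hle : ∀ p ∈ S, p.1 ≤ 1 → p.2 ≤ H)
    (hconv : ∀ p ∈ S, ∀ r ∈ S, p.1 < 1 → 1 < r.1 →
      (r.1 - 1) * p.2 + (1 - p.1) * r.2 ≤ H * (r.1 - p.1)) :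
    ∃ l : ℝ, 0 ≤ l ∧ ∀ p ∈ S, p.2 ≤ l * p.1 + (H - l) := by
  set R : Set ℝ := insert 0 {m | ∃ p ∈ S, 1 < p.1 ∧ m = (p.2 - H) / (p.1 - 1)} with hR
  have hub : ∀ p ∈ S, p.1 < 1 → ∀ m ∈ R, m ≤ (H - p.2) / (1 - p.1) := by
    intro p hp hp1 m hm
    have hp' : 0 < 1 - p.1 := sub_pos.2 hp1
    rcases hm with rfl | ⟨r, hr, hr1, rfl⟩
    · exact div_nonneg (sub_nonneg.2 (hle p hp hp1.le)) hp'.le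
    · rw [div_le_div_iff₀ (sub_pos.2 hr1) hp']
      have := hconv p hp r hr hp1 hr1
      nlinarith
  have hbdd : BddAbove R := ⟨_, hub _ h0 one_pos⟩
  refine ⟨sSup R, le_csSup hbdd (mem_insert _ _), fun p hp => ?_⟩
  rcases lt_trichotomy p.1 1 with h | h | h
  · have h1 : sSup R ≤ (H - p.2) / (1 - p.1) := csSup_le ⟨0, mem_insert _ _⟩ (hub p hp h)
    rw [le_div_iff₀ (sub_pos.2 h)] at h1
    linarith
  · have := hle p hp h.le
    rw [h]
    linarith
  · have h1 : (p.2 - H) / (p.1 - 1) ≤ sSup R := le_csSup hbdd (Or.inr ⟨p, hp, h, rfl⟩)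
    rw [div_le_iff₀ (sub_pos.2 h)] at h1
    linarith

section Amemiya

variable {T : Type*} [MeasurableSpace T] {μ : Measure T}

lemma measurable_coe_sign : Measurable fun x : ℝ => (SignType.sign x : ℝ) := by
  have : (fun x : ℝ => (SignType.sign x : ℝ)) =
      fun x => if 0 < x then 1 else if x < 0 then -1 else 0 := by
    funext x
    rw [sign_apply]
    split_ifs <;> simp
  rw [this]
  exact Measurable.ite measurableSet_Ioi measurable_const
    (Measurable.ite measurableSet_Iio measurable_const measurable_const)

lemma abs_coe_sign_le (x : ℝ) : |(SignType.sign x : ℝ)| ≤ 1 := by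
  rcases lt_trichotomy x 0 with h | rfl | h
  · simp [sign_neg h]
  · simp
  · simp [sign_pos h]

lemma modular_mono {Ψ : T → ℝ≥0∞ → ℝ≥0∞} (hmono : ∀ᵐ t ∂μ, Monotone (Ψ t)) {u w : T → ℝ}
    (h : ∀ᵐ t ∂μ, |u t| ≤ |w t|) : modular μ Ψ u ≤ modular μ Ψ w := by
  refine lintegral_mono_ae ?_
  filter_upwards [hmono, h] with t h1 h2
  exact h1 (enorm_le_iff_norm_le.2 h2)

namespace MusielakOrliczFunction

variable (Φ : MusielakOrliczFunction μ)

lemma aemeasurable_complementary_const (x : ℝ≥0) :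
    AEMeasurable (fun t => complementary Φ.toFun t x) μ :=
  aemeasurable_complementary Φ.mono (fun x => (Φ.measurable x).aemeasurable)
    (measurable_const (a := x))

lemma aemeasurable_complementary_enorm {v : T → ℝ} (hv : Measurable v) :
    AEMeasurable (fun t => complementary Φ.toFun t ‖v t‖ₑ) μ :=
  aemeasurable_complementary Φ.mono (fun x => (Φ.measurable x).aemeasurable) hv.nnnorm

/-- Multiplying v by the sign of uv does not increase its modular and turns the integrand into |uv|,
so the absolute value may be moved inside the integral. -/
lemma lintegral_enorm_mul_le {u v : T →ₘ[μ] ℝ} (hu : MemMusielakOrlicz μ Φ.toFun u)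
    (hv : modular μ (complementary Φ.toFun) v ≤ 1) :
    ∫⁻ t, ‖u t * v t‖ₑ ∂μ ≤ ENNReal.ofReal (orliczNorm μ Φ.toFun u) := by
  have hm : Measurable fun t => (SignType.sign (u t * v t) : ℝ) * v t :=
    (measurable_coe_sign.comp (u.measurable.mul v.measurable)).mul v.measurable
  set v' : T →ₘ[μ] ℝ := AEEqFun.mk _ hm.aestronglyMeasurable with hv'
  have hv'e : (v' : T → ℝ) =ᵐ[μ] fun t => (SignType.sign (u t * v t) : ℝ) * v t :=
    AEEqFun.coeFn_mk _ _
  have hv'1 : modular μ (complementary Φ.toFun) v' ≤ 1 := by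
    refine (modular_mono (Eventually.of_forall (complementary_mono _)) ?_).trans hv
    filter_upwards [hv'e] with t ht
    rw [ht, abs_mul]
    exact mul_le_of_le_one_left (abs_nonneg _) (abs_coe_sign_le _)
  have heq : (fun t => u t * v' t) =ᵐ[μ] fun t => |u t * v t| := by
    filter_upwards [hv'e] with t ht
    rw [ht, mul_left_comm, sign_mul_self]
  have h := Φ.le_orliczNorm hu hv'1
  rw [integral_congr_ae heq] at h
  have hint := (Φ.integrable_mul hu hv'1).congr heq
  have h2 := ofReal_integral_eq_lintegral_ofReal hint (Eventually.of_forall fun t => abs_nonneg _)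
  calc ∫⁻ t, ‖u t * v t‖ₑ ∂μ = ∫⁻ t, ENNReal.ofReal |u t * v t| ∂μ :=
        lintegral_congr fun t => by rw [← ofReal_norm, Real.norm_eq_abs]
    _ = ENNReal.ofReal (∫ t, |u t * v t| ∂μ) := h2.symm
    _ ≤ _ := ENNReal.ofReal_le_ofReal ((le_abs_self _).trans h)

lemma lintegral_enorm_mul_coe_le {u : T →ₘ[μ] ℝ} (hu : MemMusielakOrlicz μ Φ.toFun u) {v : T → ℝ≥0}
    (hvm : Measurable v) (hv : ∫⁻ t, complementary Φ.toFun t (v t) ∂μ ≤ 1) :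
    ∫⁻ t, v t * ‖u t‖ₑ ∂μ ≤ ENNReal.ofReal (orliczNorm μ Φ.toFun u) := by
  have hm : Measurable fun t => (v t : ℝ) := hvm.coe_nnreal_real
  set v' : T →ₘ[μ] ℝ := AEEqFun.mk _ hm.aestronglyMeasurable with hv'
  have hv'e : (v' : T → ℝ) =ᵐ[μ] fun t => (v t : ℝ) := AEEqFun.coeFn_mk _ _
  have hv'1 : modular μ (complementary Φ.toFun) v' ≤ 1 := by
    rw [modular_congr hv'e]
    refine le_trans (le_of_eq (lintegral_congr fun t => ?_)) hv
    simp
  refine le_trans (le_of_eq (lintegral_congr_ae ?_)) (Φ.lintegral_enorm_mul_le hu hv'1)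
  filter_upwards [hv'e] with t ht
  rw [ht, enorm_mul, mul_comm]
  simp

/-- The Amemiya functional comes arbitrarily close to the Orlicz norm. -/
lemma exists_one_add_modular_le [SigmaFinite μ] {u : T →ₘ[μ] ℝ}
    (hu : MemMusielakOrlicz μ Φ.toFun u) {H : ℝ} (hH : orliczNorm μ Φ.toFun u < H) :
    ∃ k : ℝ, 0 < k ∧ 1 + modular μ Φ.toFun (fun t => k * u t) ≤ ENNReal.ofReal (k * H) := by
  set N := orliczNorm μ Φ.toFun u with hN
  have hN0 : 0 ≤ N := Φ.orliczNorm_nonneg _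
  -- Pairs (s, r) for which some v ≥ 0 has I_{Φ*}(v) ≤ s and ∫ v|u| ≥ r.
  set S : Set (ℝ × ℝ) := {p | 0 ≤ p.1 ∧ 0 ≤ p.2 ∧ ∃ v : T → ℝ≥0, Measurable v ∧
    ∫⁻ t, complementary Φ.toFun t (v t) ∂μ ≤ ENNReal.ofReal p.1 ∧
    ENNReal.ofReal p.2 ≤ ∫⁻ t, v t * ‖u t‖ₑ ∂μ} with hS
  have h0 : (0, 0) ∈ S := ⟨le_rfl, le_rfl, 0, measurable_const, by simp [complementary_zero],
    by simp⟩
  have hle : ∀ p ∈ S, p.1 ≤ 1 → p.2 ≤ N := by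
    rintro p ⟨-, -, v, hvm, hv1, hv2⟩ hp
    rw [← ENNReal.ofReal_le_ofReal_iff hN0]
    refine hv2.trans (Φ.lintegral_enorm_mul_coe_le hu hvm (hv1.trans ?_))
    rw [← ENNReal.ofReal_one]
    exact ENNReal.ofReal_le_ofReal hp
  have hconv : ∀ p ∈ S, ∀ r ∈ S, p.1 < 1 → 1 < r.1 →
      (r.1 - 1) * p.2 + (1 - p.1) * r.2 ≤ N * (r.1 - p.1) := by
    rintro p ⟨hp1, hp2, v, hvm, hv1, hv2⟩ r ⟨hr1, hr2, w, hwm, hw1, hw2⟩ hp hr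
    have hd : 0 < r.1 - p.1 := by linarith
    -- The convex weights a, b are chosen with a p₁ + b r₁ = 1, so that the mixed function is
    -- admissible for the Orlicz norm.
    obtain ⟨a, ha⟩ : ∃ a : ℝ≥0, (a : ℝ) = (r.1 - 1) / (r.1 - p.1) :=
      ⟨⟨_, div_nonneg (by linarith) hd.le⟩, rfl⟩
    obtain ⟨b, hb⟩ : ∃ b : ℝ≥0, (b : ℝ) = (1 - p.1) / (r.1 - p.1) :=
      ⟨⟨_, div_nonneg (by linarith) hd.le⟩, rfl⟩
    have hab : a + b = 1 := by
      apply NNReal.coe_injective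
      push_cast
      rw [ha, hb]
      field_simp
      ring
    have hcomb : ∀ x y : ℝ, 0 ≤ x → 0 ≤ y → (a : ℝ≥0∞) * ENNReal.ofReal x + b * ENNReal.ofReal y =
        ENNReal.ofReal (((r.1 - 1) * x + (1 - p.1) * y) / (r.1 - p.1)) := by
      intro x y hx hy
      rw [← ENNReal.ofReal_coe_nnreal (p := a), ← ENNReal.ofReal_coe_nnreal (p := b),
        ← ENNReal.ofReal_mul a.coe_nonneg, ← ENNReal.ofReal_mul b.coe_nonneg,
        ← ENNReal.ofReal_add (mul_nonneg a.coe_nonneg hx) (mul_nonneg b.coe_nonneg hy), ha, hb]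
      congr 1
      ring
    have hmem : ((1 : ℝ), ((r.1 - 1) * p.2 + (1 - p.1) * r.2) / (r.1 - p.1)) ∈ S := by
      refine ⟨zero_le_one, div_nonneg (add_nonneg (mul_nonneg (by linarith) hp2)
        (mul_nonneg (by linarith) hr2)) hd.le, fun t => a * v t + b * w t,
        (hvm.const_mul a).add (hwm.const_mul b), ?_, ?_⟩
      · calc ∫⁻ t, complementary Φ.toFun t ((a * v t + b * w t : ℝ≥0) : ℝ≥0∞) ∂μ
            ≤ ∫⁻ t, (a * complementary Φ.toFun t (v t) + b * complementary Φ.toFun t (w t)) ∂μ := by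
              refine lintegral_mono fun t => ?_
              push_cast
              exact complementary_convex _ _ hab _ _
          _ = a * ∫⁻ t, complementary Φ.toFun t (v t) ∂μ +
                b * ∫⁻ t, complementary Φ.toFun t (w t) ∂μ := by
              rw [lintegral_add_left' ((aemeasurable_complementary Φ.mono
                (fun x => (Φ.measurable x).aemeasurable) hvm).const_mul _),
                lintegral_const_mul' _ _ ENNReal.coe_ne_top,
                lintegral_const_mul' _ _ ENNReal.coe_ne_top]
          _ ≤ a * ENNReal.ofReal p.1 + b * ENNReal.ofReal r.1 := by gcongr
          _ = ENNReal.ofReal 1 := by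
              rw [hcomb _ _ hp1 hr1]
              congr 1
              field_simp
              ring
      · rw [← hcomb _ _ hp2 hr2]
        calc _ ≤ a * ∫⁻ t, v t * ‖u t‖ₑ ∂μ + b * ∫⁻ t, w t * ‖u t‖ₑ ∂μ := by gcongr
          _ = ∫⁻ t, (a * (v t * ‖u t‖ₑ) + b * (w t * ‖u t‖ₑ)) ∂μ := by
              have hvu : AEMeasurable (fun t => (a : ℝ≥0∞) * (v t * ‖u t‖ₑ)) μ :=
                ((hvm.coe_nnreal_ennreal.mul u.measurable.enorm).const_mul _).aemeasurable
              rw [lintegral_add_left' hvu,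
                lintegral_const_mul' _ _ ENNReal.coe_ne_top,
                lintegral_const_mul' _ _ ENNReal.coe_ne_top]
          _ = _ := by
              refine lintegral_congr fun t => ?_
              push_cast
              ring
    have := hle _ hmem le_rfl
    rwa [div_le_iff₀ hd] at this
  obtain ⟨l, hl, hlS⟩ := exists_multiplier h0 hle hconv
  -- The multiplier l may vanish; the slack H − N makes L positive. The required k is 1/L.
  set L := l + (H - N) with hL
  have hL0 : 0 < L := by linarith
  refine ⟨L⁻¹, inv_pos.2 hL0, ?_⟩
  set y : T → ℝ≥0 := fun t => ‖L⁻¹ * u t‖₊ with hy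
  have hym : Measurable y := (u.measurable.const_mul _).nnnorm
  set I := ∫⁻ t, complementary (complementary Φ.toFun) t (y t) ∂μ with hI
  have hmodI : modular μ Φ.toFun (fun t => L⁻¹ * u t) ≤ I := by
    refine lintegral_mono_ae ?_
    filter_upwards [Φ.convexOn, Φ.lowerSemicontinuous, Φ.mono, Φ.map_zero] with t h1 h2 h3 h4
    exact le_complementary_complementary h1 h2 h3 h4 _
  refine (add_le_add_right hmodI 1).trans ?_
  -- A number below I_{Φ**}(u/L) is exceeded by some r/L − s with (s, r) ∈ S. Since r ≤ l s + (N −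
  -- l), l ≤ L and N − l = H − L, this is at most H/L − 1.
  have key : ∀ c : ℝ, 0 ≤ c → ENNReal.ofReal c < I → 1 + c < L⁻¹ * H := by
    intro c hc hcI
    obtain ⟨w, hwm, hwfin, hw⟩ := exists_lt_of_lt_lintegral_complementary
      (Eventually.of_forall (complementary_zero _)) (Eventually.of_forall (complementary_mono _))
      Φ.aemeasurable_complementary_const hym hcI
    have hwy : ∫⁻ t, w t * (y t : ℝ≥0∞) ∂μ =
        ENNReal.ofReal L⁻¹ * ∫⁻ t, w t * ‖u t‖ₑ ∂μ := by
      rw [← lintegral_const_mul' _ _ ENNReal.ofReal_ne_top]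
      refine lintegral_congr fun t => ?_
      have : (y t : ℝ≥0∞) = ENNReal.ofReal L⁻¹ * ‖u t‖ₑ := by
        change ‖L⁻¹ * u t‖ₑ = _
        rw [enorm_mul, ← ofReal_norm L⁻¹, Real.norm_of_nonneg (inv_pos.2 hL0).le]
      rw [this]
      ring
    have hJfin : ∫⁻ t, complementary Φ.toFun t (w t) ∂μ ≠ ∞ :=
      ((le_add_self).trans_lt (hw.trans hwfin)).ne
    have hLi : ENNReal.ofReal L⁻¹ ≠ 0 := by simpa using hL0
    have hrfin : ∫⁻ t, w t * ‖u t‖ₑ ∂μ ≠ ∞ := by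
      intro h
      rw [hwy, h, ENNReal.mul_top hLi] at hwfin
      exact lt_irrefl _ hwfin
    have hS' := hlS ((∫⁻ t, complementary Φ.toFun t (w t) ∂μ).toReal,
      (∫⁻ t, w t * ‖u t‖ₑ ∂μ).toReal) ⟨ENNReal.toReal_nonneg, ENNReal.toReal_nonneg, w, hwm,
        (ENNReal.ofReal_toReal hJfin).ge, (ENNReal.ofReal_toReal hrfin).le⟩
    rw [hwy] at hw
    have hw' := ENNReal.toReal_strict_mono (ENNReal.mul_ne_top ENNReal.ofReal_ne_top hrfin) hw
    rw [ENNReal.toReal_add ENNReal.ofReal_ne_top hJfin, ENNReal.toReal_mul,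
      ENNReal.toReal_ofReal hc, ENNReal.toReal_ofReal (inv_pos.2 hL0).le] at hw'
    simp only at hS'
    generalize (∫⁻ t, w t * ‖u t‖ₑ ∂μ).toReal = r at hw' hS'
    have hs : 0 ≤ (∫⁻ t, complementary Φ.toFun t (w t) ∂μ).toReal := ENNReal.toReal_nonneg
    generalize (∫⁻ t, complementary Φ.toFun t (w t) ∂μ).toReal = s at hw' hS' hs
    rw [inv_mul_eq_div, lt_div_iff₀ hL0] at hw' ⊢
    nlinarith
  have hLH : 1 ≤ L⁻¹ * H := by
    have h1 := hlS _ h0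
    rw [inv_mul_eq_div, le_div_iff₀ hL0]
    simp only at h1
    linarith
  have hIle : I ≤ ENNReal.ofReal (L⁻¹ * H - 1) := by
    refine le_of_not_gt fun hlt => ?_
    have := key _ (sub_nonneg.2 hLH) hlt
    linarith
  calc 1 + I ≤ ENNReal.ofReal 1 + ENNReal.ofReal (L⁻¹ * H - 1) := by
        rw [ENNReal.ofReal_one]
        gcongr
    _ = ENNReal.ofReal (L⁻¹ * H) := by
        rw [← ENNReal.ofReal_add zero_le_one (sub_nonneg.2 hLH), add_sub_cancel]

end MusielakOrliczFunction

end Amemiya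

/-! ### Order structure of the space and dominated convergence of modulars. -/

namespace OrliczSpace

variable {T : Type*} [MeasurableSpace T] {μ : Measure T} {Φ : MusielakOrliczFunction μ}

lemma coe_add_ae (a b : OrliczSpace Φ) : ((a + b : OrliczSpace Φ) : T →ₘ[μ] ℝ) =ᵐ[μ]
    fun t => (a : T →ₘ[μ] ℝ) t + (b : T →ₘ[μ] ℝ) t :=
  AEEqFun.coeFn_add (a : T →ₘ[μ] ℝ) (b : T →ₘ[μ] ℝ)

lemma coe_sub_ae (a b : OrliczSpace Φ) : ((a - b : OrliczSpace Φ) : T →ₘ[μ] ℝ) =ᵐ[μ]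
    fun t => (a : T →ₘ[μ] ℝ) t - (b : T →ₘ[μ] ℝ) t :=
  AEEqFun.coeFn_sub (a : T →ₘ[μ] ℝ) (b : T →ₘ[μ] ℝ)

lemma coe_smul_ae (k : ℝ) (a : OrliczSpace Φ) : ((k • a : OrliczSpace Φ) : T →ₘ[μ] ℝ) =ᵐ[μ]
    fun t => k * (a : T →ₘ[μ] ℝ) t :=
  AEEqFun.coeFn_smul k (a : T →ₘ[μ] ℝ)

lemma coe_zero_ae : ((0 : OrliczSpace Φ) : T →ₘ[μ] ℝ) =ᵐ[μ] fun _ => 0 :=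
  AEEqFun.coeFn_zero

lemma nonneg_iff_ae {a : OrliczSpace Φ} :
    0 ≤ (a : T →ₘ[μ] ℝ) ↔ ∀ᵐ t ∂μ, 0 ≤ (a : T →ₘ[μ] ℝ) t := by
  rw [← AEEqFun.coeFn_le]
  constructor
  · intro h
    filter_upwards [h, AEEqFun.coeFn_zero (β := ℝ) (μ := μ)] with t h1 h2
    simpa [h2] using h1
  · intro h
    filter_upwards [h, AEEqFun.coeFn_zero (β := ℝ) (μ := μ)] with t h1 h2
    simpa [h2] using h1

lemma le_iff_ae {a b : OrliczSpace Φ} : (a : T →ₘ[μ] ℝ) ≤ (b : T →ₘ[μ] ℝ) ↔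
    ∀ᵐ t ∂μ, (a : T →ₘ[μ] ℝ) t ≤ (b : T →ₘ[μ] ℝ) t :=
  AEEqFun.coeFn_le.symm

/-- `L^Φ` is solid. -/
lemma exists_ae_eq_of_abs_le (u : OrliczSpace Φ) {w : T → ℝ} (hw : Measurable w)
    (h : ∀ᵐ t ∂μ, |w t| ≤ |(u : T →ₘ[μ] ℝ) t|) :
    ∃ z : OrliczSpace Φ, (z : T →ₘ[μ] ℝ) =ᵐ[μ] w := by
  have he : (AEEqFun.mk w hw.aestronglyMeasurable : T →ₘ[μ] ℝ) =ᵐ[μ] w := AEEqFun.coeFn_mk _ _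
  refine ⟨⟨AEEqFun.mk w hw.aestronglyMeasurable, ?_⟩, he⟩
  obtain ⟨c, hc, hI⟩ := u.2
  refine MemMusielakOrlicz.congr he.symm ⟨c, hc, lt_of_le_of_lt (modular_mono Φ.mono ?_) hI⟩
  filter_upwards [h] with t ht
  rw [abs_mul, abs_mul]
  gcongr

lemma _root_.IncreasesTo.ae_le {w : ℕ → OrliczSpace Φ} {x : OrliczSpace Φ} (h : IncreasesTo w x) (n : ℕ) :
    ∀ᵐ t ∂μ, (w n : T →ₘ[μ] ℝ) t ≤ (x : T →ₘ[μ] ℝ) t := by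
  have h1 : ∀ᵐ t ∂μ, ∀ m, (w m : T →ₘ[μ] ℝ) t ≤ (w (m + 1) : T →ₘ[μ] ℝ) t :=
    ae_all_iff.2 fun m => le_iff_ae.1 (h.2.1 (Nat.le_succ m))
  filter_upwards [h1, h.2.2] with t h2 h3
  exact (monotone_nat_of_le_succ h2).ge_of_tendsto h3 n

lemma _root_.IncreasesTo.nonneg {w : ℕ → OrliczSpace Φ} {x : OrliczSpace Φ} (h : IncreasesTo w x) (n : ℕ) :
    ∀ᵐ t ∂μ, 0 ≤ (w n : T →ₘ[μ] ℝ) t :=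
  nonneg_iff_ae.1 (h.1 n)

lemma increasesTo_const {x : OrliczSpace Φ} (hx : ∀ᵐ t ∂μ, 0 ≤ (x : T →ₘ[μ] ℝ) t) :
    IncreasesTo (fun _ => x) x :=
  ⟨fun _ => nonneg_iff_ae.2 hx, monotone_const, Eventually.of_forall fun _ => tendsto_const_nhds⟩

lemma _root_.IncreasesTo.add {w z : ℕ → OrliczSpace Φ} {x y : OrliczSpace Φ} (hw : IncreasesTo w x)
    (hz : IncreasesTo z y) : IncreasesTo (fun n => w n + z n) (x + y) := by
  refine ⟨fun n => nonneg_iff_ae.2 ?_, monotone_nat_of_le_succ fun n => le_iff_ae.2 ?_, ?_⟩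
  · filter_upwards [coe_add_ae (w n) (z n), hw.nonneg n, hz.nonneg n] with t h1 h2 h3
    rw [h1]
    exact add_nonneg h2 h3
  · filter_upwards [coe_add_ae (w n) (z n), coe_add_ae (w (n + 1)) (z (n + 1)),
      le_iff_ae.1 (hw.2.1 (Nat.le_succ n)), le_iff_ae.1 (hz.2.1 (Nat.le_succ n))] with t h1 h2 h3 h4
    rw [h1, h2]
    exact add_le_add h3 h4
  · filter_upwards [ae_all_iff.2 fun n => coe_add_ae (w n) (z n), coe_add_ae x y, hw.2.2, hz.2.2]
      with t h1 h2 h3 h4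
    simp only [h1, h2]
    exact h3.add h4

/-- The modulars of dominated null sequences tend to zero. -/
lemma tendsto_modular_zero {x : OrliczSpace Φ}
    (hx : modular μ Φ.toFun (x : T →ₘ[μ] ℝ) < ∞) {z : ℕ → OrliczSpace Φ}
    (hz : ∀ n, ∀ᵐ t ∂μ, |(z n : T →ₘ[μ] ℝ) t| ≤ |(x : T →ₘ[μ] ℝ) t|)
    (hz0 : ∀ᵐ t ∂μ, Tendsto (fun n => (z n : T →ₘ[μ] ℝ) t) atTop (𝓝 0)) :
    Tendsto (fun n => modular μ Φ.toFun (z n : T →ₘ[μ] ℝ)) atTop (𝓝 0) := by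
  have h := tendsto_lintegral_of_dominated_convergence'
    (F := fun n t => Φ.toFun t ‖(z n : T →ₘ[μ] ℝ) t‖ₑ) (f := fun _ => 0) (μ := μ)
    (fun t => Φ.toFun t ‖(x : T →ₘ[μ] ℝ) t‖ₑ)
    (fun n => Φ.aemeasurable_comp (AEEqFun.measurable _)) (fun n => by
      filter_upwards [Φ.mono, hz n] with t h1 h2
      exact h1 (enorm_le_iff_norm_le.2 h2)) hx.ne (by
      filter_upwards [Φ.tendsto_zero, Φ.map_zero, hz0] with t h1 h2 h3
      have h4 : Tendsto (Φ.toFun t) (𝓝 0) (𝓝 0) := by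
        have h5 : 𝓝 (0 : ℝ≥0∞) = 𝓝[>] 0 ⊔ pure 0 := by
          rw [sup_comm, ← nhdsWithin_insert]
          have : insert (0 : ℝ≥0∞) (Ioi 0) = univ := by
            ext y
            simp
          rw [this, nhdsWithin_univ]
        nth_rw 1 [h5]
        refine h1.sup ?_
        rw [tendsto_pure_left]
        intro s hs
        rw [h2]
        exact mem_of_mem_nhds hs
      have h5 : Tendsto (fun n => ‖(z n : T →ₘ[μ] ℝ) t‖ₑ) atTop (𝓝 0) := by
        simpa using h3.enorm
      exact h4.comp h5)
  simpa [modular] using h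

variable [SigmaFinite μ]

lemma norm_le_of_abs_le {u z : OrliczSpace Φ}
    (h : ∀ᵐ t ∂μ, |(z : T →ₘ[μ] ℝ) t| ≤ |(u : T →ₘ[μ] ℝ) t|) : ‖z‖ ≤ ‖u‖ := by
  refine Φ.orliczNorm_le fun v hv => ?_
  rw [← ENNReal.ofReal_le_ofReal_iff (norm_nonneg u), ← Real.norm_eq_abs, ofReal_norm]
  refine (enorm_integral_le_lintegral_enorm _).trans (le_trans (lintegral_mono_ae ?_)
    (Φ.lintegral_enorm_mul_le u.2 hv))
  filter_upwards [h] with t ht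
  rw [enorm_mul, enorm_mul]
  gcongr
  exact enorm_le_iff_norm_le.2 ht

/-- The easy half of the Amemiya formula at k = 1, by Young's inequality: functions of small modular
have norm barely above 1. -/
lemma ofReal_norm_le_one_add_modular (u : OrliczSpace Φ) :
    ENNReal.ofReal ‖u‖ ≤ 1 + modular μ Φ.toFun (u : T →ₘ[μ] ℝ) := by
  rcases eq_or_ne (modular μ Φ.toFun (u : T →ₘ[μ] ℝ)) ∞ with h | h
  · simp [h]
  have h1 : 1 + modular μ Φ.toFun (u : T →ₘ[μ] ℝ) ≠ ∞ := ENNReal.add_ne_top.2 ⟨by simp, h⟩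
  refine ENNReal.ofReal_le_of_le_toReal (Φ.orliczNorm_le fun v hv => ?_)
  rw [← Real.norm_eq_abs, ← toReal_enorm]
  refine ENNReal.toReal_mono h1 ((enorm_integral_le_lintegral_enorm _).trans
    ((Φ.lintegral_mul_le _ v one_pos).trans ?_))
  simp only [inv_one, ENNReal.ofReal_one, one_mul]
  rw [add_comm]
  gcongr

/-- An element of norm less than one has a multiple `k u`, `k ≥ 1`, of finite modular. -/
lemma exists_modular_lt_top {u : OrliczSpace Φ} (hu : ‖u‖ < 1) :
    ∃ k : ℝ, 1 ≤ k ∧ modular μ Φ.toFun ((k • u : OrliczSpace Φ) : T →ₘ[μ] ℝ) < ∞ := by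
  -- With H = 1 the inequality 1 + I_Φ(ku) ≤ k gives both k ≥ 1 and finiteness.
  obtain ⟨k, hk, h⟩ := Φ.exists_one_add_modular_le u.2 hu
  refine ⟨k, ?_, ?_⟩
  · have := le_self_add.trans h
    rw [mul_one, ENNReal.one_le_ofReal] at this
    exact this
  · rw [modular_congr (coe_smul_ae k u)]
    exact (le_add_self.trans h).trans_lt ENNReal.ofReal_lt_top

/-! ### Positive parts and order continuous components of functionals. -/

section Functional

variable (f : StrongDual ℝ (OrliczSpace Φ))

lemma bddAbove_functionalPosPart (u : OrliczSpace Φ) : BddAbove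
    {r | ∃ w : OrliczSpace Φ, 0 ≤ (w : T →ₘ[μ] ℝ) ∧ (w : T →ₘ[μ] ℝ) ≤ u ∧ r = f w} := by
  refine ⟨‖f‖ * ‖u‖, ?_⟩
  rintro r ⟨w, h0, h1, rfl⟩
  refine (le_abs_self _).trans ((f.le_opNorm w).trans ?_)
  gcongr
  refine norm_le_of_abs_le ?_
  filter_upwards [nonneg_iff_ae.1 h0, le_iff_ae.1 h1] with t h2 h3
  exact abs_le_abs_of_nonneg h2 h3

variable {f}

lemma le_functionalPosPart {w u : OrliczSpace Φ} (h0 : ∀ᵐ t ∂μ, 0 ≤ (w : T →ₘ[μ] ℝ) t)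
    (h1 : ∀ᵐ t ∂μ, (w : T →ₘ[μ] ℝ) t ≤ (u : T →ₘ[μ] ℝ) t) : f w ≤ functionalPosPart f u :=
  le_csSup (bddAbove_functionalPosPart f u) ⟨w, nonneg_iff_ae.2 h0, le_iff_ae.2 h1, rfl⟩

lemma functionalPosPart_le {u : OrliczSpace Φ} (hu : ∀ᵐ t ∂μ, 0 ≤ (u : T →ₘ[μ] ℝ) t) {C : ℝ}
    (h : ∀ w : OrliczSpace Φ, (∀ᵐ t ∂μ, 0 ≤ (w : T →ₘ[μ] ℝ) t) →
      (∀ᵐ t ∂μ, (w : T →ₘ[μ] ℝ) t ≤ (u : T →ₘ[μ] ℝ) t) → f w ≤ C) :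
    functionalPosPart f u ≤ C := by
  refine csSup_le ⟨f u, u, nonneg_iff_ae.2 hu, le_rfl, rfl⟩ ?_
  rintro r ⟨w, h0, h1, rfl⟩
  exact h w (nonneg_iff_ae.1 h0) (le_iff_ae.1 h1)

lemma functionalPosPart_nonneg {u : OrliczSpace Φ} (hu : ∀ᵐ t ∂μ, 0 ≤ (u : T →ₘ[μ] ℝ) t) :
    0 ≤ functionalPosPart f u := by
  rw [← map_zero f]
  refine le_functionalPosPart ?_ ?_
  · filter_upwards [coe_zero_ae (Φ := Φ)] with t ht
    rw [ht]
  · filter_upwards [coe_zero_ae (Φ := Φ), hu] with t ht h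
    rwa [ht]

lemma functionalPosPart_mono {u w : OrliczSpace Φ} (hu : ∀ᵐ t ∂μ, 0 ≤ (u : T →ₘ[μ] ℝ) t)
    (h : ∀ᵐ t ∂μ, (u : T →ₘ[μ] ℝ) t ≤ (w : T →ₘ[μ] ℝ) t) :
    functionalPosPart f u ≤ functionalPosPart f w :=
  functionalPosPart_le hu fun z h0 h1 => le_functionalPosPart h0 <| by
    filter_upwards [h, h1] with t h2 h3 using h3.trans h2

/-- Riesz decomposition: 0 ≤ w ≤ a + b splits as min(w, a) plus a remainder between 0 and b. -/
lemma functionalPosPart_add_le {a b : OrliczSpace Φ} (ha : ∀ᵐ t ∂μ, 0 ≤ (a : T →ₘ[μ] ℝ) t)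
    (hb : ∀ᵐ t ∂μ, 0 ≤ (b : T →ₘ[μ] ℝ) t) :
    functionalPosPart f (a + b) ≤ functionalPosPart f a + functionalPosPart f b := by
  refine functionalPosPart_le ?_ fun w h0 h1 => ?_
  · filter_upwards [ha, hb, coe_add_ae a b] with t h1 h2 h3
    rw [h3]
    exact add_nonneg h1 h2
  obtain ⟨z, hz⟩ := exists_ae_eq_of_abs_le a
    (w := fun t => min ((w : T →ₘ[μ] ℝ) t) ((a : T →ₘ[μ] ℝ) t))
    ((AEEqFun.measurable _).min (AEEqFun.measurable _)) (by
      filter_upwards [h0, ha] with t h2 h3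
      exact abs_le_abs_of_nonneg (le_min h2 h3) (min_le_right _ _))
  have hw : f w = f z + f (w - z) := by rw [← map_add, add_sub_cancel]
  rw [hw]
  refine add_le_add (le_functionalPosPart ?_ ?_) (le_functionalPosPart ?_ ?_)
  · filter_upwards [hz, h0, ha] with t h2 h3 h4
    rw [h2]
    exact le_min h3 h4
  · filter_upwards [hz] with t h2
    rw [h2]
    exact min_le_right _ _
  · filter_upwards [hz, coe_sub_ae w z] with t h2 h3
    rw [h3, h2]
    exact sub_nonneg.2 (min_le_left _ _)
  · filter_upwards [hz, coe_sub_ae w z, coe_add_ae a b, h1, hb] with t h2 h3 h4 h5 h6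
    rw [h4] at h5
    rw [h3, h2]
    rcases min_choice ((w : T →ₘ[μ] ℝ) t) ((a : T →ₘ[μ] ℝ) t) with h | h <;> rw [h] <;> linarith

/-- The positive and negative parts of a functional are disjoint. -/
lemma exists_functionalPosPart_le {x : OrliczSpace Φ} (hx : ∀ᵐ t ∂μ, 0 ≤ (x : T →ₘ[μ] ℝ) t)
    {ε : ℝ} (hε : 0 < ε) : ∃ w : OrliczSpace Φ, (∀ᵐ t ∂μ, 0 ≤ (w : T →ₘ[μ] ℝ) t) ∧
      (∀ᵐ t ∂μ, (w : T →ₘ[μ] ℝ) t ≤ (x : T →ₘ[μ] ℝ) t) ∧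
      functionalPosPart (-f) w ≤ ε ∧ functionalPosPart f (x - w) ≤ ε := by
  -- Let w nearly attain f⁺(x). Removing a piece z ≤ w, or adding a piece z ≤ x − w, cannot raise
  -- f(w) by more than ε.
  obtain ⟨r, ⟨w, h0, h1, rfl⟩, hr⟩ := exists_lt_of_lt_csSup
    (by exact ⟨f x, x, nonneg_iff_ae.2 hx, le_rfl, rfl⟩)
    (sub_lt_self (functionalPosPart f x) hε)
  rw [nonneg_iff_ae] at h0
  rw [le_iff_ae] at h1
  refine ⟨w, h0, h1, functionalPosPart_le h0 fun z hz hzw => ?_, functionalPosPart_le ?_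
    fun z hz hzw => ?_⟩
  · have : f (w - z) ≤ functionalPosPart f x := by
      refine le_functionalPosPart ?_ ?_
      · filter_upwards [coe_sub_ae w z, hzw] with t h2 h3
        rw [h2]
        exact sub_nonneg.2 h3
      · filter_upwards [coe_sub_ae w z, hz, h1] with t h2 h3 h4
        rw [h2]
        linarith
    rw [map_sub] at this
    rw [neg_apply]
    linarith
  · filter_upwards [coe_sub_ae x w, h1] with t h2 h3
    rw [h2]
    exact sub_nonneg.2 h3
  · have : f (w + z) ≤ functionalPosPart f x := by
      refine le_functionalPosPart ?_ ?_
      · filter_upwards [coe_add_ae w z, hz, h0] with t h2 h3 h4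
        rw [h2]
        exact add_nonneg h4 h3
      · filter_upwards [coe_add_ae w z, coe_sub_ae x w, hzw] with t h2 h3 h4
        rw [h3] at h4
        rw [h2]
        linarith
    rw [map_add] at this
    linarith

lemma _root_.IncreasesTo.bddAbove {w : ℕ → OrliczSpace Φ} {x : OrliczSpace Φ} (h : IncreasesTo w x) :
    BddAbove (range fun n => functionalPosPart f (w n)) := by
  refine ⟨functionalPosPart f x, ?_⟩
  rintro _ ⟨n, rfl⟩
  exact functionalPosPart_mono (h.nonneg n) (h.ae_le n)

lemma bddBelow_positiveOrderContinuousPart (x : OrliczSpace Φ) : BddBelow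
    {r | ∃ w : ℕ → OrliczSpace Φ, IncreasesTo w x ∧ r = ⨆ n, functionalPosPart f (w n)} := by
  refine ⟨0, ?_⟩
  rintro r ⟨w, hw, rfl⟩
  exact (functionalPosPart_nonneg (hw.nonneg 0)).trans (le_ciSup hw.bddAbove 0)

lemma positiveOrderContinuousPart_le {x : OrliczSpace Φ} {w : ℕ → OrliczSpace Φ}
    (hw : IncreasesTo w x) {C : ℝ} (hC : ∀ n, functionalPosPart f (w n) ≤ C) :
    positiveOrderContinuousPart (functionalPosPart f) x ≤ C :=
  csInf_le_of_le (bddBelow_positiveOrderContinuousPart x) ⟨w, hw, rfl⟩ (ciSup_le hC)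

lemma exists_increasesTo_lt {x : OrliczSpace Φ} (hx : ∀ᵐ t ∂μ, 0 ≤ (x : T →ₘ[μ] ℝ) t) {C : ℝ}
    (hC : positiveOrderContinuousPart (functionalPosPart f) x < C) :
    ∃ w : ℕ → OrliczSpace Φ, IncreasesTo w x ∧ ∀ n, functionalPosPart f (w n) < C := by
  obtain ⟨r, ⟨w, hw, rfl⟩, hr⟩ := exists_lt_of_csInf_lt
    (by exact ⟨_, _, increasesTo_const hx, rfl⟩) hC
  exact ⟨w, hw, fun n => (le_ciSup hw.bddAbove n).trans_lt hr⟩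

lemma positiveOrderContinuousPart_add_le {x y : OrliczSpace Φ}
    (hx : ∀ᵐ t ∂μ, 0 ≤ (x : T →ₘ[μ] ℝ) t) (hy : ∀ᵐ t ∂μ, 0 ≤ (y : T →ₘ[μ] ℝ) t) :
    positiveOrderContinuousPart (functionalPosPart f) (x + y) ≤
      positiveOrderContinuousPart (functionalPosPart f) x +
        positiveOrderContinuousPart (functionalPosPart f) y := by
  refine le_of_forall_pos_le_add fun ε hε => ?_
  obtain ⟨w, hw, hw'⟩ := exists_increasesTo_lt (f := f) hx (lt_add_of_pos_right _ (half_pos hε))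
  obtain ⟨z, hz, hz'⟩ := exists_increasesTo_lt (f := f) hy (lt_add_of_pos_right _ (half_pos hε))
  refine positiveOrderContinuousPart_le (hw.add hz) fun n => ?_
  have := functionalPosPart_add_le (f := f) (hw.nonneg n) (hz.nonneg n)
  linarith [hw' n, hz' n]

end Functional

end OrliczSpace

/-! ### Purely singular functionals. -/

namespace IsPurelySingular

open OrliczSpace

variable {T : Type*} [MeasurableSpace T] {μ : Measure T} [SigmaFinite μ]
  {Φ : MusielakOrliczFunction μ} {f : StrongDual ℝ (OrliczSpace Φ)}

lemma positiveOrderContinuousPart_eq (hf : IsPurelySingular f) {x : OrliczSpace Φ}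
    (hx : ∀ᵐ t ∂μ, 0 ≤ (x : T →ₘ[μ] ℝ) t) :
    positiveOrderContinuousPart (functionalPosPart f) x =
      positiveOrderContinuousPart (functionalPosPart (-f)) x :=
  sub_eq_zero.1 (hf x (nonneg_iff_ae.2 hx))

/-- Both the positive and the negative part of a purely singular functional are purely singular. -/
lemma positiveOrderContinuousPart_nonpos (hf : IsPurelySingular f) {x : OrliczSpace Φ}
    (hx : ∀ᵐ t ∂μ, 0 ≤ (x : T →ₘ[μ] ℝ) t) :
    positiveOrderContinuousPart (functionalPosPart f) x ≤ 0 := by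
  refine le_of_forall_pos_le_add fun ε hε => ?_
  -- Pure singularity only says that (f⁺)_c and (f⁻)_c coincide. On w the component (f⁺)_c equals
  -- (f⁻)_c, which is small because f⁻(w) is; on x − w already f⁺ is small.
  obtain ⟨w, h0, h1, h2, h3⟩ := exists_functionalPosPart_le (f := f) hx (half_pos hε)
  have h4 : ∀ᵐ t ∂μ, 0 ≤ ((x - w : OrliczSpace Φ) : T →ₘ[μ] ℝ) t := by
    filter_upwards [coe_sub_ae x w, h1] with t h2 h3
    rw [h2]
    exact sub_nonneg.2 h3
  have h5 := positiveOrderContinuousPart_add_le (f := f) h0 h4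
  rw [add_sub_cancel, hf.positiveOrderContinuousPart_eq h0] at h5
  have h6 := positiveOrderContinuousPart_le (increasesTo_const h0) fun _ => h2
  have h7 := positiveOrderContinuousPart_le (increasesTo_const h4) fun _ => h3
  linarith

/-- Every `x ∈ L^Φ` is the limit of elements `m n`, dominated by `x`, on whose order intervals a
given purely singular functional is small. -/
lemma exists_truncation (hf : IsPurelySingular f) (x : OrliczSpace Φ) {ε : ℝ} (hε : 0 < ε) :
    ∃ m : ℕ → OrliczSpace Φ,
      (∀ n, ∀ᵐ t ∂μ, |(m n : T →ₘ[μ] ℝ) t| ≤ |(x : T →ₘ[μ] ℝ) t|) ∧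
      (∀ n, ∀ᵐ t ∂μ, |(x : T →ₘ[μ] ℝ) t - (m n : T →ₘ[μ] ℝ) t| ≤ |(x : T →ₘ[μ] ℝ) t|) ∧
      (∀ᵐ t ∂μ, Tendsto (fun n => (m n : T →ₘ[μ] ℝ) t) atTop (𝓝 ((x : T →ₘ[μ] ℝ) t))) ∧
      ∀ n, ∀ z : OrliczSpace Φ,
        (∀ᵐ t ∂μ, |(z : T →ₘ[μ] ℝ) t| ≤ |(m n : T →ₘ[μ] ℝ) t|) → |f z| ≤ ε := by
  obtain ⟨y, hy⟩ := exists_ae_eq_of_abs_le x (w := fun t => |(x : T →ₘ[μ] ℝ) t|)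
    (AEEqFun.measurable _).abs (by simp)
  have hy0 : ∀ᵐ t ∂μ, 0 ≤ (y : T →ₘ[μ] ℝ) t := by
    filter_upwards [hy] with t ht
    rw [ht]
    exact abs_nonneg _
  have hp := hf.positiveOrderContinuousPart_nonpos hy0
  have hn := hp
  rw [hf.positiveOrderContinuousPart_eq hy0] at hn
  obtain ⟨p, hpy, hpε⟩ := exists_increasesTo_lt hy0 (hp.trans_lt (half_pos hε))
  obtain ⟨q, hqy, hqε⟩ := exists_increasesTo_lt hy0 (hn.trans_lt (half_pos hε))
  -- Here p n ↑ |x| keeps f⁺ small and q n ↑ |x| keeps f⁻ small. Their minimum, with the sign of x,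
  -- does both and still converges to x.
  have hex : ∀ n, ∃ z : OrliczSpace Φ, (z : T →ₘ[μ] ℝ) =ᵐ[μ] fun t =>
      (SignType.sign ((x : T →ₘ[μ] ℝ) t) : ℝ) *
        min ((p n : T →ₘ[μ] ℝ) t) ((q n : T →ₘ[μ] ℝ) t) := by
    intro n
    refine exists_ae_eq_of_abs_le (p n) ((measurable_coe_sign.comp (AEEqFun.measurable _)).mul
      ((AEEqFun.measurable _).min (AEEqFun.measurable _))) ?_
    filter_upwards [hpy.nonneg n, hqy.nonneg n] with t h1 h2
    rw [abs_mul, abs_of_nonneg (le_min h1 h2), abs_of_nonneg h1]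
    exact (mul_le_of_le_one_left (le_min h1 h2) (abs_coe_sign_le _)).trans (min_le_left _ _)
  choose m hm using hex
  have hlt : ∀ n, ∀ᵐ t ∂μ, |(m n : T →ₘ[μ] ℝ) t| ≤ (p n : T →ₘ[μ] ℝ) t ∧
      |(m n : T →ₘ[μ] ℝ) t| ≤ (q n : T →ₘ[μ] ℝ) t := by
    intro n
    filter_upwards [hm n, hpy.nonneg n, hqy.nonneg n] with t h0 h1 h2
    have h3 : |(m n : T →ₘ[μ] ℝ) t| ≤ min ((p n : T →ₘ[μ] ℝ) t) ((q n : T →ₘ[μ] ℝ) t) := by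
      rw [h0, abs_mul, abs_of_nonneg (le_min h1 h2)]
      exact mul_le_of_le_one_left (le_min h1 h2) (abs_coe_sign_le _)
    exact ⟨h3.trans (min_le_left _ _), h3.trans (min_le_right _ _)⟩
  refine ⟨m, fun n => ?_, fun n => ?_, ?_, fun n z hz => ?_⟩
  · filter_upwards [hlt n, hpy.ae_le n, hy] with t h1 h2 h3
    rw [h3] at h2
    exact h1.1.trans h2
  · filter_upwards [hm n, hpy.nonneg n, hqy.nonneg n, hpy.ae_le n, hy] with t h0 h1 h2 h3 h4
    rw [h4] at h3
    have h5 := le_min h1 h2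
    have h6 := (min_le_left _ ((q n : T →ₘ[μ] ℝ) t)).trans h3
    rw [h0]
    generalize min ((p n : T →ₘ[μ] ℝ) t) ((q n : T →ₘ[μ] ℝ) t) = r at h5 h6 ⊢
    generalize (x : T →ₘ[μ] ℝ) t = s at h6 ⊢
    rcases lt_trichotomy s 0 with h | rfl | h
    · rw [abs_of_neg h] at h6 ⊢
      simp only [sign_neg h, SignType.coe_neg_one]
      rw [abs_le]
      constructor <;> linarith
    · simp
    · rw [abs_of_pos h] at h6 ⊢
      simp only [sign_pos h, SignType.coe_one]
      rw [abs_le]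
      constructor <;> linarith
  · filter_upwards [ae_all_iff.2 hm, hpy.2.2, hqy.2.2, hy] with t h0 h1 h2 h3
    simp only [h0]
    rw [h3] at h1 h2
    have := (h1.min h2).const_mul (SignType.sign ((x : T →ₘ[μ] ℝ) t) : ℝ)
    rwa [min_self, sign_mul_abs] at this
  -- Split z into positive and negative parts. Each lies between 0 and both p n and q n, so f is
  -- within ε/2 of 0 on it.
  · obtain ⟨a, ha⟩ := exists_ae_eq_of_abs_le z (w := fun t => max ((z : T →ₘ[μ] ℝ) t) 0)
      ((AEEqFun.measurable _).max measurable_const) (Eventually.of_forall fun t => by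
        rw [abs_of_nonneg (le_max_right _ _)]
        exact max_le (le_abs_self _) (abs_nonneg _))
    have hb : ((a - z : OrliczSpace Φ) : T →ₘ[μ] ℝ) =ᵐ[μ] fun t => max (-(z : T →ₘ[μ] ℝ) t) 0 := by
      filter_upwards [coe_sub_ae a z, ha] with t h1 h2
      rw [h1, h2, ← max_sub_sub_right, sub_self, zero_sub, max_comm]
    have hz' : z = a - (a - z) := by abel
    have hside : ∀ g : OrliczSpace Φ, ((g : T →ₘ[μ] ℝ) =ᵐ[μ] (fun t => max ((z : T →ₘ[μ] ℝ) t) 0) ∨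
        (g : T →ₘ[μ] ℝ) =ᵐ[μ] fun t => max (-(z : T →ₘ[μ] ℝ) t) 0) →
        f g ≤ ε / 2 ∧ -(ε / 2) ≤ f g := by
      intro g hg
      have hg0 : ∀ᵐ t ∂μ, 0 ≤ (g : T →ₘ[μ] ℝ) t := by
        rcases hg with hg | hg <;> filter_upwards [hg] with t ht <;> rw [ht] <;>
          exact le_max_right _ _
      have hgz : ∀ᵐ t ∂μ, (g : T →ₘ[μ] ℝ) t ≤ |(z : T →ₘ[μ] ℝ) t| := by
        rcases hg with hg | hg <;> filter_upwards [hg] with t ht <;> rw [ht]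
        · exact max_le (le_abs_self _) (abs_nonneg _)
        · exact max_le (neg_le_abs _) (abs_nonneg _)
      have h1 : f g ≤ functionalPosPart f (p n) := le_functionalPosPart hg0 (by
        filter_upwards [hgz, hz, hlt n] with t h1 h2 h3 using h1.trans (h2.trans h3.1))
      have h2 : (-f) g ≤ functionalPosPart (-f) (q n) := le_functionalPosPart hg0 (by
        filter_upwards [hgz, hz, hlt n] with t h1 h2 h3 using h1.trans (h2.trans h3.2))
      rw [neg_apply] at h2
      exact ⟨h1.trans (hpε n).le, by linarith [hqε n]⟩
    have h1 := hside a (Or.inl ha)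
    have h2 := hside _ (Or.inr hb)
    rw [hz', map_sub, abs_le]
    constructor <;> linarith [h1.1, h1.2, h2.1, h2.2]

/-- A purely singular functional is bounded by its norm on the functions of finite modular. -/
lemma abs_apply_le_norm (hf : IsPurelySingular f) {x : OrliczSpace Φ}
    (hx : modular μ Φ.toFun (x : T →ₘ[μ] ℝ) < ∞) : |f x| ≤ ‖f‖ := by
  refine le_of_forall_pos_le_add fun ε hε => ?_
  obtain ⟨m, -, hm2, hm3, hm4⟩ := hf.exists_truncation x (half_pos hε)
  -- The remainders x − m n have modular tending to 0, hence norm at most 1 + δ eventually, while f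
  -- nearly vanishes on m n.
  have hz : Tendsto (fun n => modular μ Φ.toFun ((x - m n : OrliczSpace Φ) : T →ₘ[μ] ℝ)) atTop
      (𝓝 0) := by
    refine tendsto_modular_zero hx (fun n => ?_) ?_
    · filter_upwards [hm2 n, coe_sub_ae x (m n)] with t h1 h2
      rwa [h2]
    · filter_upwards [hm3, ae_all_iff.2 fun n => coe_sub_ae x (m n)] with t h1 h2
      simp only [h2]
      simpa using h1.const_sub ((x : T →ₘ[μ] ℝ) t)
  set δ := ε / (2 * (‖f‖ + 1)) with hδ
  have hf0 := norm_nonneg f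
  have hδ0 : 0 < δ := by positivity
  obtain ⟨n, hn⟩ := (hz.eventually_lt_const (ENNReal.ofReal_pos.2 hδ0)).exists
  have h1 : ‖x - m n‖ ≤ 1 + δ := by
    rw [← ENNReal.ofReal_le_ofReal_iff (by positivity), ENNReal.ofReal_add zero_le_one hδ0.le,
      ENNReal.ofReal_one]
    exact (ofReal_norm_le_one_add_modular _).trans (by gcongr)
  have h2 : |f (m n)| ≤ ε / 2 := hm4 n _ (Eventually.of_forall fun _ => le_rfl)
  have h3 : |f (x - m n)| ≤ ‖f‖ * (1 + δ) := (f.le_opNorm _).trans (by gcongr)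
  have h4 : ‖f‖ * δ ≤ ε / 2 := by
    rw [hδ, mul_div_assoc', div_le_div_iff₀ (by positivity) two_pos]
    nlinarith
  have h5 : f x = f (m n) + f (x - m n) := by rw [← map_add, add_sub_cancel]
  rw [h5]
  refine (abs_add_le _ _).trans ?_
  linarith

/-- A purely singular functional vanishes on the order continuous elements. -/
lemma apply_eq_zero (hf : IsPurelySingular f) {x : OrliczSpace Φ}
    (hx : ∀ k : ℝ, 0 < k → modular μ Φ.toFun (fun t => k * (x : T →ₘ[μ] ℝ) t) < ∞) : f x = 0 := by
  by_contra h
  have h0 := abs_pos.2 h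
  -- All multiples of x have finite modular; this one would give |f| the value ‖f‖ + 1, above the
  -- bound ‖f‖.
  have hk : 0 < (‖f‖ + 1) / |f x| := by positivity
  have h1 : |f (((‖f‖ + 1) / |f x|) • x)| ≤ ‖f‖ := hf.abs_apply_le_norm (by
    rw [modular_congr (coe_smul_ae _ x)]
    exact hx _ hk)
  rw [map_smul, smul_eq_mul, abs_mul, abs_of_pos hk, div_mul_cancel₀ _ h0.ne'] at h1
  linarith

end IsPurelySingular

/-! ### The unit ball of the dual: I_{Φ*}(v) + ‖f_s‖ ≤ 1. -/

namespace OrliczSpace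

variable {T : Type*} [MeasurableSpace T] {μ : Measure T} {Φ : MusielakOrliczFunction μ}

lemma integrable_mul_of_mem (w : OrliczSpace Φ) {v : T →ₘ[μ] ℝ}
    (hv : MemMusielakOrlicz μ (complementary Φ.toFun) v) :
    Integrable (fun t => (w : T →ₘ[μ] ℝ) t * v t) μ := by
  obtain ⟨c, hc, hcv⟩ := hv
  obtain ⟨d, hd, hdw⟩ := w.2
  have h := Φ.lintegral_mul_le (w : T →ₘ[μ] ℝ) (c • v) hd
  rw [modular_congr (AEEqFun.coeFn_smul c v)] at h
  have hint : Integrable (fun t => (w : T →ₘ[μ] ℝ) t * (c • v : T →ₘ[μ] ℝ) t) μ :=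
    ⟨(AEEqFun.aestronglyMeasurable _).mul (AEEqFun.aestronglyMeasurable _), h.trans_lt
      (ENNReal.mul_lt_top ENNReal.ofReal_lt_top (ENNReal.add_lt_top.2 ⟨hdw, hcv⟩))⟩
  refine (hint.const_mul c⁻¹).congr ?_
  filter_upwards [AEEqFun.coeFn_smul c v] with t ht
  rw [ht, Pi.smul_apply, smul_eq_mul]
  field_simp

lemma ae_enorm_le_finiteBound {v : T →ₘ[μ] ℝ} (hv : modular μ (complementary Φ.toFun) v ≤ 1) :
    ∀ᵐ t ∂μ, ‖v t‖ₑ ≤ finiteBound (complementary Φ.toFun) t := by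
  filter_upwards [ae_lt_top' (Φ.aemeasurable_complementary_enorm v.measurable)
    (hv.trans_lt ENNReal.one_lt_top).ne] with t ht
  exact le_sSup ht

lemma tendsto_integral_abs_mul_zero {v : T →ₘ[μ] ℝ} {x : OrliczSpace Φ}
    (hv : MemMusielakOrlicz μ (complementary Φ.toFun) v) {z : ℕ → OrliczSpace Φ}
    (hz : ∀ n, ∀ᵐ t ∂μ, |(z n : T →ₘ[μ] ℝ) t| ≤ |(x : T →ₘ[μ] ℝ) t|)
    (hz0 : ∀ᵐ t ∂μ, Tendsto (fun n => (z n : T →ₘ[μ] ℝ) t) atTop (𝓝 0)) :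
    Tendsto (fun n => ∫ t, |(z n : T →ₘ[μ] ℝ) t * v t| ∂μ) atTop (𝓝 0) := by
  have h := tendsto_integral_of_dominated_convergence (μ := μ)
    (F := fun n t => |(z n : T →ₘ[μ] ℝ) t * v t|) (f := fun _ => 0)
    (fun t => |(x : T →ₘ[μ] ℝ) t * v t|)
    (fun n => (AEEqFun.measurable _).mul (AEEqFun.measurable _) |>.abs.aestronglyMeasurable)
    (integrable_mul_of_mem x hv).abs (fun n => by
      filter_upwards [hz n] with t ht
      rw [Real.norm_eq_abs, abs_abs, abs_mul, abs_mul]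
      gcongr) (by
      filter_upwards [hz0] with t ht
      simpa using (ht.mul_const (v t)).abs)
  simpa using h

lemma abs_integral_mul_le {v : T →ₘ[μ] ℝ} {a x : OrliczSpace Φ}
    (hv : MemMusielakOrlicz μ (complementary Φ.toFun) v)
    (h : ∀ᵐ t ∂μ, |(a : T →ₘ[μ] ℝ) t| ≤ |(x : T →ₘ[μ] ℝ) t|) :
    |∫ t, (a : T →ₘ[μ] ℝ) t * v t ∂μ| ≤ ∫ t, |(x : T →ₘ[μ] ℝ) t * v t| ∂μ := by
  refine (abs_integral_le_integral_abs).trans (integral_mono_ae (integrable_mul_of_mem a hv).abs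
    (integrable_mul_of_mem x hv).abs ?_)
  filter_upwards [h] with t ht
  simp only [abs_mul]
  gcongr

lemma integral_sub_mul {v : T →ₘ[μ] ℝ} (hv : MemMusielakOrlicz μ (complementary Φ.toFun) v)
    (a b : OrliczSpace Φ) : ∫ t, ((a - b : OrliczSpace Φ) : T →ₘ[μ] ℝ) t * v t ∂μ =
      ∫ t, (a : T →ₘ[μ] ℝ) t * v t ∂μ - ∫ t, (b : T →ₘ[μ] ℝ) t * v t ∂μ := by
  rw [← integral_sub (integrable_mul_of_mem a hv) (integrable_mul_of_mem b hv)]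
  refine integral_congr_ae ?_
  filter_upwards [coe_sub_ae a b] with t ht
  rw [ht, sub_mul]

variable [SigmaFinite μ]

/-- A functional whose regular part `v` and singular part `fs` satisfy `I_{Φ*}(v) + ‖fs‖ ≤ 1` has
norm at most one. -/
lemma norm_le_one_of_modular_add_le {f fs : StrongDual ℝ (OrliczSpace Φ)} {v : T →ₘ[μ] ℝ}
    (hfs : IsPurelySingular fs)
    (hf : ∀ w : OrliczSpace Φ, f w = (∫ t, (w : T →ₘ[μ] ℝ) t * v t ∂μ) + fs w)
    (h : modular μ (complementary Φ.toFun) v + ENNReal.ofReal ‖fs‖ ≤ 1) : ‖f‖ ≤ 1 := by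
  have hJ : modular μ (complementary Φ.toFun) v ≠ ∞ :=
    ((le_self_add.trans h).trans_lt ENNReal.one_lt_top).ne
  have h' := ENNReal.toReal_mono ENNReal.one_ne_top h
  rw [ENNReal.toReal_add hJ ENNReal.ofReal_ne_top, ENNReal.toReal_ofReal (norm_nonneg _),
    ENNReal.toReal_one] at h'
  refine f.opNorm_le_bound zero_le_one fun w => ?_
  rw [one_mul]
  refine le_of_forall_gt_imp_ge_of_dense fun H hH => ?_
  -- For this k, Young's inequality gives k|f(w)| ≤ I_Φ(kw) + I_{Φ*}(v) + ‖f_s‖ ≤ I_Φ(kw) + 1 ≤ kH.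
  obtain ⟨k, hk, hkH⟩ := Φ.exists_one_add_modular_le w.2 hH
  have hH0 : 0 < H := (norm_nonneg w).trans_lt hH
  have hI : modular μ Φ.toFun (fun t => k * (w : T →ₘ[μ] ℝ) t) ≠ ∞ :=
    ((le_add_self.trans hkH).trans_lt ENNReal.ofReal_lt_top).ne
  have h1 := ENNReal.toReal_mono ENNReal.ofReal_ne_top hkH
  rw [ENNReal.toReal_add ENNReal.one_ne_top hI, ENNReal.toReal_one,
    ENNReal.toReal_ofReal (by positivity)] at h1
  have h2 := ENNReal.toReal_mono (ENNReal.mul_ne_top ENNReal.ofReal_ne_top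
    (ENNReal.add_ne_top.2 ⟨hI, hJ⟩)) ((enorm_integral_le_lintegral_enorm _).trans
      (Φ.lintegral_mul_le (w : T →ₘ[μ] ℝ) v hk))
  rw [toReal_enorm, ENNReal.toReal_mul, ENNReal.toReal_add hI hJ,
    ENNReal.toReal_ofReal (inv_pos.2 hk).le, Real.norm_eq_abs, inv_mul_eq_div,
    le_div_iff₀ hk] at h2
  have h3 : |fs (k • w)| ≤ ‖fs‖ := hfs.abs_apply_le_norm (by
    rw [modular_congr (coe_smul_ae _ w)]
    exact hI.lt_top)
  rw [map_smul, smul_eq_mul, abs_mul, abs_of_pos hk] at h3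
  have h4 := abs_add_le (∫ t, (w : T →ₘ[μ] ℝ) t * v t ∂μ) (fs w)
  rw [hf w, Real.norm_eq_abs, ← mul_le_mul_iff_of_pos_left hk]
  nlinarith

/-- An almost maximizer in the open unit ball becomes a function of finite modular after scaling by
some k ≥ 1. Choosing its sign so that the value is nonnegative ensures that scaling does not
decrease it. -/
lemma exists_lt_apply_of_pos {fs : StrongDual ℝ (OrliczSpace Φ)} {ε : ℝ} (hε : 0 < ε) :
    ∃ x : OrliczSpace Φ, modular μ Φ.toFun (x : T →ₘ[μ] ℝ) < ∞ ∧ ‖fs‖ - ε < fs x := by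
  obtain ⟨x, hx, hfx⟩ := fs.exists_lt_apply_of_lt_opNorm (sub_lt_self ‖fs‖ hε)
  rw [Real.norm_eq_abs] at hfx
  obtain ⟨y, hy, hfy, hy0⟩ : ∃ y : OrliczSpace Φ, ‖y‖ < 1 ∧ ‖fs‖ - ε < fs y ∧ 0 ≤ fs y := by
    rcases le_total 0 (fs x) with h | h
    · exact ⟨x, hx, by rwa [abs_of_nonneg h] at hfx, h⟩
    · refine ⟨-x, by rwa [norm_neg], ?_, ?_⟩
      · rwa [map_neg, ← abs_of_nonpos h]
      · rw [map_neg]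
        linarith
  obtain ⟨k, hk, hI⟩ := exists_modular_lt_top hy
  refine ⟨k • y, hI, ?_⟩
  rw [map_smul, smul_eq_mul]
  nlinarith

/-- Every purely singular functional almost attains its norm at functions of arbitrarily small
modular. -/
lemma exists_small_of_isPurelySingular {fs : StrongDual ℝ (OrliczSpace Φ)} {v : T →ₘ[μ] ℝ}
    (hv : MemMusielakOrlicz μ (complementary Φ.toFun) v) (hfs : IsPurelySingular fs)
    {ε : ℝ} (hε : 0 < ε) : ∃ x : OrliczSpace Φ, ‖fs‖ - ε < fs x ∧
      modular μ Φ.toFun (x : T →ₘ[μ] ℝ) < ENNReal.ofReal ε ∧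
      ∫ t, |(x : T →ₘ[μ] ℝ) t * v t| ∂μ < ε := by
  obtain ⟨x, hx, hfx⟩ := exists_lt_apply_of_pos (fs := fs) (half_pos hε)
  -- Subtracting m n costs at most ε/2 in `fs`, and the remainder tends to 0 both in modular and
  -- against v.
  obtain ⟨m, -, hm2, hm3, hm4⟩ := hfs.exists_truncation x (half_pos hε)
  have hd : ∀ n, ∀ᵐ t ∂μ, |((x - m n : OrliczSpace Φ) : T →ₘ[μ] ℝ) t| ≤
      |(x : T →ₘ[μ] ℝ) t| := by
    intro n
    filter_upwards [hm2 n, coe_sub_ae x (m n)] with t h1 h2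
    rwa [h2]
  have hl : ∀ᵐ t ∂μ, Tendsto (fun n => ((x - m n : OrliczSpace Φ) : T →ₘ[μ] ℝ) t) atTop
      (𝓝 0) := by
    filter_upwards [hm3, ae_all_iff.2 fun n => coe_sub_ae x (m n)] with t h1 h2
    simp only [h2]
    simpa using h1.const_sub ((x : T →ₘ[μ] ℝ) t)
  obtain ⟨n, h1, h2⟩ := (((tendsto_modular_zero hx hd hl).eventually_lt_const
    (ENNReal.ofReal_pos.2 hε)).and
      ((tendsto_integral_abs_mul_zero hv hd hl).eventually_lt_const hε)).exists
  refine ⟨x - m n, ?_, h1, h2⟩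
  have := (abs_le.1 (hm4 n _ (Eventually.of_forall fun _ => le_rfl))).2
  rw [map_sub]
  linarith

/-- A test function for the modular of the regular part can be combined with almost maximizers of
the singular part. -/
lemma add_norm_le_one {f fs : StrongDual ℝ (OrliczSpace Φ)} {v : T →ₘ[μ] ℝ}
    (hv : MemMusielakOrlicz μ (complementary Φ.toFun) v) (hfs : IsPurelySingular fs)
    (hf : ∀ w : OrliczSpace Φ, f w = (∫ t, (w : T →ₘ[μ] ℝ) t * v t ∂μ) + fs w)
    (hf1 : ‖f‖ ≤ 1) {w : OrliczSpace Φ} (hw : modular μ Φ.toFun (w : T →ₘ[μ] ℝ) < ∞) {c : ℝ}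
    (hc : c + (modular μ Φ.toFun (w : T →ₘ[μ] ℝ)).toReal ≤ ∫ t, (w : T →ₘ[μ] ℝ) t * v t ∂μ) :
    c + ‖fs‖ ≤ 1 := by
  refine le_of_forall_pos_le_add fun δ hδ => ?_
  -- Six errors of size ε arise in bounding f(a + b) from below, and one in bounding ‖a + b‖ from
  -- above.
  obtain ⟨ε, hε, rfl⟩ : ∃ ε > 0, δ = 7 * ε := ⟨δ / 7, by positivity, by ring⟩
  obtain ⟨m, hm1, hm2, hm3, hm4⟩ := hfs.exists_truncation w hε
  have hlim : Tendsto (fun n => ∫ t, |((w - m n : OrliczSpace Φ) : T →ₘ[μ] ℝ) t * v t| ∂μ) atTop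
      (𝓝 0) := by
    refine tendsto_integral_abs_mul_zero (x := w) hv (fun n => ?_) ?_
    · filter_upwards [hm2 n, coe_sub_ae w (m n)] with t h1 h2
      rwa [h2]
    · filter_upwards [hm3, ae_all_iff.2 fun n => coe_sub_ae w (m n)] with t h1 h2
      simp only [h2]
      simpa using h1.const_sub ((w : T →ₘ[μ] ℝ) t)
  obtain ⟨n, hn⟩ := (hlim.eventually_lt_const hε).exists
  have hMs := hm4 n
  have hMw : modular μ Φ.toFun (m n : T →ₘ[μ] ℝ) ≤ modular μ Φ.toFun (w : T →ₘ[μ] ℝ) :=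
    modular_mono Φ.mono (hm1 n)
  generalize m n = M at hn hMs hMw
  have hwM := (abs_integral_mul_le hv (a := w - M) (Eventually.of_forall fun _ => le_rfl)).trans
    hn.le
  rw [integral_sub_mul hv] at hwM
  obtain ⟨X, hX1, hX2, hX3⟩ := exists_small_of_isPurelySingular hv hfs hε
  -- Glue X on D to M off D. The dropped part of X is dominated by M, where `fs` is small; the
  -- dropped part of M is dominated by X, whose integral against v is small. The modular is at most
  -- I_Φ(X) + I_Φ(w).
  set D : Set T := {t | |(M : T →ₘ[μ] ℝ) t| < |(X : T →ₘ[μ] ℝ) t|} with hD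
  have hDm : MeasurableSet D := measurableSet_lt (AEEqFun.measurable _).abs
    (AEEqFun.measurable _).abs
  obtain ⟨a, ha⟩ := exists_ae_eq_of_abs_le X (w := D.indicator (X : T →ₘ[μ] ℝ))
    ((AEEqFun.measurable _).indicator hDm) (Eventually.of_forall fun t => by
      by_cases ht : t ∈ D <;> simp [ht])
  obtain ⟨b, hb⟩ := exists_ae_eq_of_abs_le M (w := Dᶜ.indicator (M : T →ₘ[μ] ℝ))
    ((AEEqFun.measurable _).indicator hDm.compl) (Eventually.of_forall fun t => by
      by_cases ht : t ∈ D <;> simp [ht])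
  have h1 : |fs (X - a)| ≤ ε := hMs _ (by
    filter_upwards [coe_sub_ae X a, ha] with t h1 h2
    rw [h1, h2]
    by_cases ht : t ∈ D
    · simp [ht]
    · simpa [ht] using not_lt.1 (show ¬ (|(M : T →ₘ[μ] ℝ) t| < |(X : T →ₘ[μ] ℝ) t|) from ht))
  have h2 : |fs b| ≤ ε := hMs _ (by
    filter_upwards [hb] with t h1
    rw [h1]
    by_cases ht : t ∈ D <;> simp [ht])
  have h3 : |∫ t, (a : T →ₘ[μ] ℝ) t * v t ∂μ| ≤ ε :=
    (abs_integral_mul_le hv (x := X) (by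
      filter_upwards [ha] with t h1
      rw [h1]
      by_cases ht : t ∈ D <;> simp [ht])).trans hX3.le
  have h4 : |∫ t, ((M - b : OrliczSpace Φ) : T →ₘ[μ] ℝ) t * v t ∂μ| ≤ ε :=
    (abs_integral_mul_le hv (x := X) (by
      filter_upwards [coe_sub_ae M b, hb] with t h1 h2
      rw [h1, h2]
      by_cases ht : t ∈ D
      · simpa [ht] using (show |(M : T →ₘ[μ] ℝ) t| < |(X : T →ₘ[μ] ℝ) t| from ht).le
      · simp [ht])).trans hX3.le
  rw [integral_sub_mul hv] at h4
  have h5 : modular μ Φ.toFun ((a + b : OrliczSpace Φ) : T →ₘ[μ] ℝ) ≤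
      modular μ Φ.toFun (X : T →ₘ[μ] ℝ) + modular μ Φ.toFun (w : T →ₘ[μ] ℝ) := by
    refine le_trans ?_ (add_le_add_right hMw _)
    rw [modular, modular, modular, ← lintegral_add_left' (Φ.aemeasurable_comp (AEEqFun.measurable _))]
    refine lintegral_mono_ae ?_
    filter_upwards [coe_add_ae a b, ha, hb] with t h1 h2 h3
    rw [h1, h2, h3]
    by_cases ht : t ∈ D
    · simp [ht]
    · simp [ht]
  have h6 : f (a + b) ≤ 1 + (ε + (modular μ Φ.toFun (w : T →ₘ[μ] ℝ)).toReal) := by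
    refine (le_abs_self _).trans ((f.le_opNorm _).trans ?_)
    refine (mul_le_of_le_one_left (norm_nonneg _) hf1).trans ?_
    have h7 : ENNReal.ofReal ‖a + b‖ ≤ 1 + (ENNReal.ofReal ε + modular μ Φ.toFun
        (w : T →ₘ[μ] ℝ)) := (ofReal_norm_le_one_add_modular _).trans (by
      gcongr
      exact h5.trans (by gcongr))
    have h8 := ENNReal.toReal_mono (by simp [hw.ne]) h7
    rwa [ENNReal.toReal_ofReal (norm_nonneg _), ENNReal.toReal_add (by simp) (by simp [hw.ne]),
      ENNReal.toReal_add (by simp) hw.ne, ENNReal.toReal_one, ENNReal.toReal_ofReal hε.le] at h8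
  rw [map_add, hf a, hf b] at h6
  rw [map_sub] at h1
  rw [abs_le] at h1 h2 h3 h4 hwM
  linarith [h1.1, h1.2, h2.1, h3.1, h4.1, h4.2, hwM.1, hwM.2]

/-- A functional of norm at most one has a regular part `v` and a singular part `fs` with
`I_{Φ*}(v) + ‖fs‖ ≤ 1`. -/
lemma modular_add_le_of_norm_le_one {f fs : StrongDual ℝ (OrliczSpace Φ)} {v : T →ₘ[μ] ℝ}
    (hv : MemMusielakOrlicz μ (complementary Φ.toFun) v) (hfs : IsPurelySingular fs)
    (hf : ∀ w : OrliczSpace Φ, f w = (∫ t, (w : T →ₘ[μ] ℝ) t * v t ∂μ) + fs w)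
    (hf1 : ‖f‖ ≤ 1) : modular μ (complementary Φ.toFun) v + ENNReal.ofReal ‖fs‖ ≤ 1 := by
  have hzero : modular μ Φ.toFun ((0 : OrliczSpace Φ) : T →ₘ[μ] ℝ) = 0 := by
    rw [modular, ← lintegral_zero (μ := μ)]
    refine lintegral_congr_ae ?_
    filter_upwards [Φ.map_zero, coe_zero_ae (Φ := Φ)] with t h1 h2
    rw [h2, enorm_zero, h1]
  -- The zero test function gives ‖f_s‖ ≤ 1, so the truncated difference 1 − ‖f_s‖ below is a
  -- genuine one.
  have h0 : ENNReal.ofReal ‖fs‖ ≤ 1 := by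
    have := add_norm_le_one hv hfs hf hf1 (w := 0) (c := 0)
      (hzero.trans_lt ENNReal.zero_lt_top) (by
      rw [hzero, ENNReal.toReal_zero, add_zero]
      refine (integral_eq_zero_of_ae ?_).ge
      filter_upwards [coe_zero_ae (Φ := Φ)] with t ht
      rw [ht, zero_mul, Pi.zero_apply])
    rw [← ENNReal.ofReal_one]
    exact ENNReal.ofReal_le_ofReal (by linarith)
  suffices h : modular μ (complementary Φ.toFun) v ≤ 1 - ENNReal.ofReal ‖fs‖ from
    (add_le_add_left h _).trans (tsub_add_cancel_of_le h0).le
  refine le_of_forall_lt_imp_le_of_dense fun c hc => ?_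
  obtain ⟨w, hwm, hwfin, hw⟩ := exists_lt_of_lt_lintegral_complementary (y := fun t => ‖v t‖₊)
    Φ.map_zero Φ.mono (fun x => (Φ.measurable x).aemeasurable) v.measurable.nnnorm hc
  have hIfin : ∫⁻ t, Φ.toFun t (w t) ∂μ < ∞ := (le_add_self.trans_lt hw).trans hwfin
  have hWm : Measurable fun t => (SignType.sign (v t) : ℝ) * w t :=
    (measurable_coe_sign.comp v.measurable).mul hwm.coe_nnreal_real
  -- The sign of v turns ∫ W v into ∫ w|v|. Off the support of v it sets W to 0, which can only
  -- lower the modular.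
  set W : T →ₘ[μ] ℝ := AEEqFun.mk _ hWm.aestronglyMeasurable with hW
  have hWe : (W : T → ℝ) =ᵐ[μ] fun t => (SignType.sign (v t) : ℝ) * w t := AEEqFun.coeFn_mk _ _
  have hWI : modular μ Φ.toFun W ≤ ∫⁻ t, Φ.toFun t (w t) ∂μ := by
    refine lintegral_mono_ae ?_
    filter_upwards [Φ.mono, hWe] with t h1 h2
    refine h1 ?_
    have h3 : ‖W t‖ₑ ≤ ‖(w t : ℝ)‖ₑ := by
      rw [enorm_le_iff_norm_le, h2, norm_mul]
      exact mul_le_of_le_one_left (norm_nonneg _) (abs_coe_sign_le _)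
    simpa using h3
  have hWmem : MemMusielakOrlicz μ Φ.toFun W := ⟨1, one_pos, by
    simpa using hWI.trans_lt hIfin⟩
  have hint : ∫ t, W t * v t ∂μ = (∫⁻ t, w t * (‖v t‖₊ : ℝ≥0∞) ∂μ).toReal := by
    have hWv : (fun t => W t * v t) =ᵐ[μ] fun t => (w t : ℝ) * |v t| := by
      filter_upwards [hWe] with t ht
      rw [ht, mul_right_comm, sign_mul_self, mul_comm]
    have hwv : Measurable fun t => (w t : ℝ) * |v t| := hwm.coe_nnreal_real.mul v.measurable.abs
    rw [integral_congr_ae hWv, integral_eq_lintegral_of_nonneg_ae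
      (Eventually.of_forall fun t => mul_nonneg (w t).coe_nonneg (abs_nonneg _))
      hwv.aestronglyMeasurable]
    congr 1
    refine lintegral_congr fun t => ?_
    rw [ENNReal.ofReal_mul (w t).coe_nonneg, ENNReal.ofReal_coe_nnreal, ← Real.norm_eq_abs,
      ofReal_norm]
    rfl
  have hcfin : c ≠ ∞ := (le_self_add.trans_lt (hw.trans hwfin)).ne
  have h1 := add_norm_le_one hv hfs hf hf1 (w := ⟨W, hWmem⟩) (c := c.toReal)
    (hWI.trans_lt hIfin) (by
      change c.toReal + (modular μ Φ.toFun W).toReal ≤ ∫ t, W t * v t ∂μ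
      rw [hint, ← ENNReal.toReal_add hcfin (hWI.trans_lt hIfin).ne]
      exact ENNReal.toReal_mono hwfin.ne ((add_le_add_right hWI c).trans hw.le))
  refine ENNReal.le_sub_of_add_le_right ENNReal.ofReal_ne_top ?_
  rw [← ENNReal.ofReal_toReal hcfin, ← ENNReal.ofReal_add ENNReal.toReal_nonneg (norm_nonneg _),
    ← ENNReal.ofReal_one]
  exact ENNReal.ofReal_le_ofReal h1

end OrliczSpace

/-! ### Consequences of an unattained Amemiya norm. -/

section AmemiyaMinimizers

variable {T : Type*} [MeasurableSpace T] {μ : Measure T} (Φ : MusielakOrliczFunction μ)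

namespace MusielakOrliczFunction

lemma amemiyaNorm_le [SigmaFinite μ] {u : T →ₘ[μ] ℝ} (hu : MemMusielakOrlicz μ Φ.toFun u) :
    amemiyaNorm μ Φ.toFun u ≤ ENNReal.ofReal (orliczNorm μ Φ.toFun u) := by
  refine ENNReal.le_of_forall_pos_le_add fun ε hε _ => ?_
  obtain ⟨k, hk, h⟩ := Φ.exists_one_add_modular_le hu
    (lt_add_of_pos_right (orliczNorm μ Φ.toFun u) (NNReal.coe_pos.2 hε))
  refine (iInf₂_le k hk).trans ?_
  rw [← ENNReal.ofReal_coe_nnreal, ← ENNReal.ofReal_add (Φ.orliczNorm_nonneg _) ε.coe_nonneg]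
  refine (mul_le_mul_right h _).trans ?_
  rw [← ENNReal.ofReal_mul (by positivity), one_div, inv_mul_cancel_left₀ hk.ne']

lemma one_add_modular_eq (u : T → ℝ) {k : ℝ} (hk : 0 < k) :
    1 + modular μ Φ.toFun (fun t => k * u t) =
      ENNReal.ofReal k * amemiyaFunctional μ Φ.toFun u k := by
  rw [amemiyaFunctional, ← mul_assoc, ← ENNReal.ofReal_mul hk.le, mul_one_div_cancel hk.ne',
    ENNReal.ofReal_one, one_mul]

/-- `k ↦ Φ(t, k x) / k` is increasing. -/
lemma div_mono : ∀ᵐ t ∂μ, ∀ (x : ℝ) {j k : ℝ}, 0 < j → j ≤ k →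
    ENNReal.ofReal (1 / j) * Φ.toFun t ‖j * x‖ₑ ≤ ENNReal.ofReal (1 / k) * Φ.toFun t ‖k * x‖ₑ := by
  filter_upwards [Φ.star] with t h x j k hj hjk
  have hk : 0 < k := hj.trans_le hjk
  have h1 : ‖j * x‖ₑ = ((j / k).toNNReal : ℝ≥0∞) * ‖k * x‖ₑ := by
    rw [enorm_mul, enorm_mul, ← mul_assoc, ← ofReal_norm j, ← ofReal_norm k,
      Real.norm_of_nonneg hj.le, Real.norm_of_nonneg hk.le]
    congr 1
    change _ = ENNReal.ofReal (j / k) * _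
    rw [← ENNReal.ofReal_mul (by positivity), div_mul_cancel₀ _ hk.ne']
  have h2 : (j / k).toNNReal ≤ 1 := by
    rw [Real.toNNReal_le_one]
    exact div_le_one_of_le₀ hjk hk.le
  rw [h1]
  refine (mul_le_mul_right (h _ _ h2) _).trans (le_of_eq ?_)
  rw [← mul_assoc]
  congr 1
  change _ * ENNReal.ofReal (j / k) = _
  rw [← ENNReal.ofReal_mul (by positivity)]
  congr 1
  field_simp

/-- Fatou's lemma with the lower semicontinuity of Φ(t,·): k ↦ I_Φ(ku) is lower semicontinuous, so
cluster points of minimizing sequences are minimizers. -/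
lemma modular_le_of_tendsto {u : T → ℝ} (hu : Measurable u) {k : ℕ → ℝ} {k₀ : ℝ}
    (hk : Tendsto k atTop (𝓝 k₀)) {L : ℝ≥0∞}
    (hL : Tendsto (fun n => modular μ Φ.toFun (fun t => k n * u t)) atTop (𝓝 L)) :
    modular μ Φ.toFun (fun t => k₀ * u t) ≤ L := by
  rw [← hL.liminf_eq]
  refine le_trans (lintegral_mono_ae ?_)
    (lintegral_liminf_le' fun n => Φ.aemeasurable_comp (hu.const_mul _))
  filter_upwards [Φ.lowerSemicontinuous] with t ht
  refine le_of_forall_lt_imp_le_of_dense fun c hc => ?_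
  have h1 : Tendsto (fun n => ‖k n * u t‖ₑ) atTop (𝓝 ‖k₀ * u t‖ₑ) := (hk.mul_const _).enorm
  exact le_liminf_of_le (by isBoundedDefault)
    ((h1.eventually (ht _ c hc)).mono fun n hn => le_of_lt hn)

/-- If the Amemiya norm of `u` is not attained, then it is approached along a sequence tending to
infinity. -/
lemma exists_tendsto_atTop_of_amemiyaMinimizers_eq_empty {u : T → ℝ} (hu : Measurable u)
    (hfin : amemiyaNorm μ Φ.toFun u ≠ ∞) (hK : amemiyaMinimizers μ Φ.toFun u = ∅) :
    ∃ k : ℕ → ℝ, Tendsto k atTop atTop ∧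
      Tendsto (fun n => amemiyaFunctional μ Φ.toFun u (k n)) atTop
        (𝓝 (amemiyaNorm μ Φ.toFun u)) := by
  set A := amemiyaNorm μ Φ.toFun u with hA
  have hAeq : A = sInf (amemiyaFunctional μ Φ.toFun u '' Ioi 0) := by
    rw [sInf_image]
    rfl
  obtain ⟨r, -, hr, hrm⟩ := exists_seq_tendsto_sInf
    (nonempty_Ioi.image (amemiyaFunctional μ Φ.toFun u)) (OrderBot.bddBelow _)
  choose k hk hkr using hrm
  rw [← hAeq] at hr
  have hkA : Tendsto (fun n => amemiyaFunctional μ Φ.toFun u (k n)) atTop (𝓝 A) := by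
    simpa only [hkr] using hr
  refine ⟨k, ?_, hkA⟩
  by_contra hnot
  rw [tendsto_atTop] at hnot
  push Not at hnot
  obtain ⟨N, hN⟩ := hnot
  -- The functional is at least 1/k, which keeps a minimizing sequence away from 0.
  have hlow : ∀ᶠ n in atTop, (A.toReal + 1)⁻¹ ≤ k n := by
    have h1 : ∀ᶠ n in atTop, amemiyaFunctional μ Φ.toFun u (k n) < A + 1 :=
      hkA.eventually_lt_const (ENNReal.lt_add_right hfin one_ne_zero)
    filter_upwards [h1] with n hn
    have hk0 : 0 < k n := hk n
    have h2 : ENNReal.ofReal (1 / k n) ≤ A + 1 :=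
      (le_mul_of_one_le_right zero_le le_self_add).trans hn.le
    have h3 := ENNReal.toReal_mono (by simp [hfin]) h2
    rw [ENNReal.toReal_ofReal (by positivity), ENNReal.toReal_add hfin ENNReal.one_ne_top,
      ENNReal.toReal_one, one_div] at h3
    exact inv_le_of_inv_le₀ hk0 h3
  -- If k n does not tend to infinity, infinitely many terms lie in a compact interval of (0, ∞). A
  -- cluster point then attains the infimum, contradicting `hK`.
  have hfreq : ∃ᶠ n in atTop, k n ∈ Icc (A.toReal + 1)⁻¹ N := by
    refine (hN.and_eventually hlow).mono fun n hn => ⟨hn.2, ?_⟩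
    exact hn.1.le
  obtain ⟨k₀, hk₀, φ, hφ, hlim⟩ := isCompact_Icc.tendsto_subseq' hfreq
  have hk₀pos : 0 < k₀ := lt_of_lt_of_le
    (inv_pos.2 (add_pos_of_nonneg_of_pos ENNReal.toReal_nonneg one_pos)) hk₀.1
  have hB : Tendsto (fun n => 1 + modular μ Φ.toFun (fun t => k (φ n) * u t)) atTop
      (𝓝 (ENNReal.ofReal k₀ * A)) := by
    have h1 := ENNReal.Tendsto.mul (ENNReal.tendsto_ofReal hlim) (Or.inr hfin)
      (hkA.comp hφ.tendsto_atTop) (Or.inr ENNReal.ofReal_ne_top)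
    refine h1.congr fun n => ?_
    exact (Φ.one_add_modular_eq u (hk (φ n))).symm
  have hI : Tendsto (fun n => modular μ Φ.toFun (fun t => k (φ n) * u t)) atTop
      (𝓝 (ENNReal.ofReal k₀ * A - 1)) := by
    have h1 := ENNReal.Tendsto.sub hB (tendsto_const_nhds (x := (1 : ℝ≥0∞)))
      (Or.inr ENNReal.one_ne_top)
    refine h1.congr fun n => ?_
    exact ENNReal.add_sub_cancel_left ENNReal.one_ne_top
  have h1 : 1 ≤ ENNReal.ofReal k₀ * A :=
    ge_of_tendsto hB (Eventually.of_forall fun n => le_self_add)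
  have h2 : 1 + modular μ Φ.toFun (fun t => k₀ * u t) ≤ ENNReal.ofReal k₀ * A := by
    refine (add_le_add_right (Φ.modular_le_of_tendsto hu hlim hI) 1).trans ?_
    rw [add_tsub_cancel_of_le h1]
  have h3 : amemiyaFunctional μ Φ.toFun u k₀ ≤ A := by
    refine (mul_le_mul_right h2 _).trans (le_of_eq ?_)
    rw [← mul_assoc, ← ENNReal.ofReal_mul (by positivity), one_div_mul_cancel hk₀pos.ne',
      ENNReal.ofReal_one, one_mul]
  have h4 : k₀ ∈ amemiyaMinimizers μ Φ.toFun u :=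
    ⟨hk₀pos, le_antisymm h3 (iInf₂_le k₀ hk₀pos)⟩
  rw [hK] at h4
  exact h4

/-- I_Φ(ju)/j is at most I_Φ(ku)/k for k ≥ j, hence at most the Amemiya functional at k. Let k run
to infinity along the minimizing sequence. -/
lemma modular_div_le_of_amemiyaMinimizers_eq_empty {u : T → ℝ} (hu : Measurable u)
    (hfin : amemiyaNorm μ Φ.toFun u ≠ ∞) (hK : amemiyaMinimizers μ Φ.toFun u = ∅) {j : ℝ}
    (hj : 0 < j) :
    ENNReal.ofReal (1 / j) * modular μ Φ.toFun (fun t => j * u t) ≤ amemiyaNorm μ Φ.toFun u := by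
  obtain ⟨k, hk, hkA⟩ := Φ.exists_tendsto_atTop_of_amemiyaMinimizers_eq_empty hu hfin hK
  refine ge_of_tendsto hkA ?_
  filter_upwards [hk.eventually_ge_atTop j] with n hn
  refine le_trans ?_ (mul_le_mul_right (le_add_self :
    modular μ Φ.toFun (fun t => k n * u t) ≤ 1 + _) _)
  rw [modular, modular, ← lintegral_const_mul' _ _ ENNReal.ofReal_ne_top,
    ← lintegral_const_mul' _ _ ENNReal.ofReal_ne_top]
  refine lintegral_mono_ae ?_
  filter_upwards [Φ.div_mono] with t ht
  exact ht _ hj hn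

lemma modular_lt_top_of_amemiyaMinimizers_eq_empty {u : T → ℝ} (hu : Measurable u)
    (hfin : amemiyaNorm μ Φ.toFun u ≠ ∞) (hK : amemiyaMinimizers μ Φ.toFun u = ∅) {j : ℝ}
    (hj : 0 < j) : modular μ Φ.toFun (fun t => j * u t) < ∞ := by
  have h := (Φ.modular_div_le_of_amemiyaMinimizers_eq_empty hu hfin hK hj).trans_lt hfin.lt_top
  refine lt_top_iff_ne_top.2 fun htop => ?_
  rw [htop, ENNReal.mul_top (by simpa using hj)] at h
  exact lt_irrefl _ h

/-- The recession function `sup_n Φ(t, n x) / n`. -/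
noncomputable def recession (t : T) (x : ℝ) : ℝ≥0∞ :=
  ⨆ n : ℕ, ENNReal.ofReal (1 / (n + 1)) * Φ.toFun t ‖((n : ℝ) + 1) * x‖ₑ

lemma aemeasurable_recession {u : T → ℝ} (hu : Measurable u) :
    AEMeasurable (fun t => Φ.recession t (u t)) μ :=
  AEMeasurable.iSup fun _ => (Φ.aemeasurable_comp (hu.const_mul _)).const_mul _

lemma lintegral_recession_le {u : T → ℝ} (hu : Measurable u)
    (hfin : amemiyaNorm μ Φ.toFun u ≠ ∞) (hK : amemiyaMinimizers μ Φ.toFun u = ∅) :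
    ∫⁻ t, Φ.recession t (u t) ∂μ ≤ amemiyaNorm μ Φ.toFun u := by
  unfold recession
  rw [lintegral_iSup' (fun n => (Φ.aemeasurable_comp (hu.const_mul _)).const_mul _)]
  · refine iSup_le fun n => ?_
    rw [lintegral_const_mul' _ _ ENNReal.ofReal_ne_top]
    exact Φ.modular_div_le_of_amemiyaMinimizers_eq_empty hu hfin hK (by positivity)
  · filter_upwards [Φ.div_mono] with t ht
    intro m n hmn
    exact ht _ (by positivity) (by gcongr)

/-- For Φ*(t,y) < ∞, divide Young's inequality at the points (n+1)|x| and y by n + 1; the term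
Φ*(t,y)/(n+1) vanishes in the limit. -/
lemma mul_finiteBound_le_recession (t : T) (x : ℝ) :
    ‖x‖ₑ * finiteBound (complementary Φ.toFun) t ≤ Φ.recession t x := by
  rw [finiteBound, ENNReal.mul_sSup]
  refine iSup₂_le fun y hy => ?_
  have hy' : complementary Φ.toFun t y < ∞ := hy
  have hlim : Tendsto (fun n : ℕ => Φ.recession t x +
      ENNReal.ofReal (1 / (n + 1)) * complementary Φ.toFun t y) atTop
      (𝓝 (Φ.recession t x + 0)) := by
    refine tendsto_const_nhds.add ?_
    have h1 := ENNReal.tendsto_ofReal (tendsto_one_div_add_atTop_nhds_zero_nat (𝕜 := ℝ))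
    have h2 := ENNReal.Tendsto.mul_const h1 (Or.inr hy'.ne)
    simpa using h2
  rw [add_zero] at hlim
  refine ge_of_tendsto hlim (Eventually.of_forall fun n => ?_)
  have hn : (0 : ℝ) < n + 1 := by positivity
  have h1 : (‖((n : ℝ) + 1) * x‖ₑ) * y ≤ Φ.toFun t ‖((n : ℝ) + 1) * x‖ₑ +
    complementary Φ.toFun t y := young_inequality Φ.toFun t ‖((n : ℝ) + 1) * x‖₊ y
  have h2 := mul_le_mul_right h1 (ENNReal.ofReal (1 / ((n : ℝ) + 1)))
  rw [enorm_mul, ← ofReal_norm ((n : ℝ) + 1), Real.norm_of_nonneg hn.le, mul_assoc, ← mul_assoc,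
    ← ENNReal.ofReal_mul (by positivity), one_div_mul_cancel hn.ne', ENNReal.ofReal_one, one_mul,
    mul_add, ← Real.norm_of_nonneg hn.le, ofReal_norm, ← enorm_mul, Real.norm_of_nonneg hn.le] at h2
  refine h2.trans (add_le_add_left ?_ _)
  exact le_iSup (fun n : ℕ => ENNReal.ofReal (1 / ((n : ℝ) + 1)) *
    Φ.toFun t ‖((n : ℝ) + 1) * x‖ₑ) n

end MusielakOrliczFunction

end AmemiyaMinimizers

/-! ### The characterization of support functionals. -/

/-- Condition (ii) lives in `EReal` because b may be infinite; equality with a real number forces b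
to be finite and splits into a modulus and a sign condition. -/
lemma coe_eq_sign_mul_coe_iff {x y : ℝ} {b : ℝ≥0∞} (hx : x ≠ 0) :
    ((y : ℝ) : EReal) = ((SignType.sign x : ℝ) : EReal) * (b : EReal) ↔ b = ‖y‖ₑ ∧ 0 ≤ x * y := by
  have key : ∀ z : ℝ, ((z : ℝ) : EReal) = (b : EReal) ↔ b = ‖z‖ₑ ∧ 0 ≤ z := by
    intro z
    constructor
    · intro h
      have hz : 0 ≤ z := by
        rw [← EReal.coe_nonneg, h]
        exact EReal.coe_ennreal_nonneg b
      refine ⟨?_, hz⟩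
      rw [Real.enorm_of_nonneg hz, ← EReal.coe_ennreal_eq_coe_ennreal_iff, ← h,
        EReal.coe_ennreal_ofReal, max_eq_left hz]
    · rintro ⟨rfl, hz⟩
      rw [Real.enorm_of_nonneg hz, EReal.coe_ennreal_ofReal, max_eq_left hz]
  rcases lt_or_gt_of_ne hx with h | h
  · rw [sign_neg h]
    simp only [SignType.coe_neg_one, EReal.coe_neg, EReal.coe_one, neg_mul, one_mul]
    rw [← neg_eq_iff_eq_neg, ← EReal.coe_neg, key, enorm_neg]
    refine and_congr_right fun _ => ?_
    constructor
    · intro hy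
      nlinarith
    · intro hy
      by_contra! hy'
      nlinarith
  · rw [sign_pos h]
    simp only [SignType.coe_one, EReal.coe_one, one_mul]
    rw [key]
    exact and_congr_right fun _ => (mul_nonneg_iff_of_pos_left h).symm

theorem mainTheorem5 {T : Type*} [MeasurableSpace T] (μ : Measure T) [SigmaFinite μ]
    (hμ : NonatomicMeasure μ) (Φ : MusielakOrliczFunction μ)
    (u : OrliczSpace Φ) (hu : u ≠ 0)
    (hK : amemiyaMinimizers μ Φ.toFun (u : T →ₘ[μ] ℝ) = ∅)
    (f fs : StrongDual ℝ (OrliczSpace Φ)) (v : T →ₘ[μ] ℝ)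
    (hv : MemMusielakOrlicz μ (complementary Φ.toFun) v)
    (hfs : IsPurelySingular fs)
    (hf : ∀ w : OrliczSpace Φ, f w = (∫ t, (w : T →ₘ[μ] ℝ) t * v t ∂μ) + fs w) :
    IsSupportFunctional f u ↔
      (modular μ (complementary Φ.toFun) v + ENNReal.ofReal ‖fs‖ ≤ 1 ∧
        ∀ᵐ t ∂μ, t ∈ Function.support (u : T →ₘ[μ] ℝ) →
          ((v t : ℝ) : EReal) = ((SignType.sign ((u : T →ₘ[μ] ℝ) t) : ℝ) : EReal) *
            (finiteBound (complementary Φ.toFun) t : EReal)) := by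
  have hum : Measurable (u : T →ₘ[μ] ℝ) := AEEqFun.measurable _
  have hA : amemiyaNorm μ Φ.toFun (u : T →ₘ[μ] ℝ) ≤ ENNReal.ofReal ‖u‖ := Φ.amemiyaNorm_le u.2
  have hAfin : amemiyaNorm μ Φ.toFun (u : T →ₘ[μ] ℝ) ≠ ∞ := ne_top_of_le_ne_top
    ENNReal.ofReal_ne_top hA
  have hfsu : fs u = 0 := hfs.apply_eq_zero fun k hk =>
    Φ.modular_lt_top_of_amemiyaMinimizers_eq_empty hum hAfin hK hk
  have hfu : f u = ∫ t, (u : T →ₘ[μ] ℝ) t * v t ∂μ := by rw [hf, hfsu, add_zero]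
  have hint : Integrable (fun t => (u : T →ₘ[μ] ℝ) t * v t) μ := OrliczSpace.integrable_mul_of_mem u hv
  constructor
  · rintro ⟨hf1, hfu1⟩
    have hi := OrliczSpace.modular_add_le_of_norm_le_one hv hfs hf hf1.le
    have hv1 : modular μ (complementary Φ.toFun) v ≤ 1 := le_self_add.trans hi
    refine ⟨hi, ?_⟩
    have hchain : ∀ᵐ t ∂μ, ‖(u : T →ₘ[μ] ℝ) t * v t‖ₑ ≤
        ‖(u : T →ₘ[μ] ℝ) t‖ₑ * finiteBound (complementary Φ.toFun) t := by
      filter_upwards [OrliczSpace.ae_enorm_le_finiteBound hv1] with t ht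
      rw [enorm_mul]
      gcongr
    have hpos : ∀ t, ENNReal.ofReal ((u : T →ₘ[μ] ℝ) t * v t) ≤ ‖(u : T →ₘ[μ] ℝ) t * v t‖ₑ :=
      fun t => Real.ofReal_le_enorm _
    have hposfin : ∫⁻ t, ENNReal.ofReal ((u : T →ₘ[μ] ℝ) t * v t) ∂μ ≠ ∞ :=
      ((lintegral_mono hpos).trans_lt hint.2).ne
    -- The hypothesis f(u) = ‖u‖ closes the chain: the integral of the recession function is at most
    -- the Amemiya norm, hence at most ‖u‖ = ∫ uv ≤ ∫ (uv)⁺.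
    have hle : ∫⁻ t, Φ.recession t ((u : T →ₘ[μ] ℝ) t) ∂μ ≤
        ∫⁻ t, ENNReal.ofReal ((u : T →ₘ[μ] ℝ) t * v t) ∂μ := by
      refine (Φ.lintegral_recession_le hum hAfin hK).trans (hA.trans ?_)
      rw [← hfu1, hfu]
      refine ENNReal.ofReal_le_of_le_toReal ?_
      rw [integral_eq_lintegral_pos_part_sub_lintegral_neg_part hint]
      exact sub_le_self _ ENNReal.toReal_nonneg
    -- Pointwise (uv)⁺ ≤ |uv| ≤ |u| b_{Φ*} ≤ recession, and the integrals of the two ends compare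
    -- the other way. So all four agree a.e., giving |v| = b_{Φ*} and uv ≥ 0 where u ≠ 0.
    have hae := ae_eq_of_ae_le_of_lintegral_le (μ := μ) (by
      filter_upwards [hchain] with t ht
      exact (hpos t).trans (ht.trans (Φ.mul_finiteBound_le_recession t _))) hposfin
      (Φ.aemeasurable_recession hum) hle
    filter_upwards [hae, hchain] with t h1 h2 hut
    have hut' : (u : T →ₘ[μ] ℝ) t ≠ 0 := hut
    have h3 := Φ.mul_finiteBound_le_recession t ((u : T →ₘ[μ] ℝ) t)
    rw [← h1] at h3
    rw [coe_eq_sign_mul_coe_iff hut']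
    have h4 : ‖(u : T →ₘ[μ] ℝ) t‖ₑ * finiteBound (complementary Φ.toFun) t =
        ‖(u : T →ₘ[μ] ℝ) t‖ₑ * ‖v t‖ₑ := by
      rw [← enorm_mul]
      exact le_antisymm (h3.trans (hpos t)) h2
    refine ⟨(ENNReal.mul_right_inj (enorm_ne_zero.2 hut') enorm_ne_top).1 h4, ?_⟩
    by_contra! hneg
    have h5 := h2.trans h3
    rw [ENNReal.ofReal_of_nonpos hneg.le, nonpos_iff_eq_zero, enorm_eq_zero] at h5
    exact hneg.ne h5
  · rintro ⟨hi, hii⟩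
    have hf1 : ‖f‖ ≤ 1 := OrliczSpace.norm_le_one_of_modular_add_le hfs hf hi
    have hii' : ∀ᵐ t ∂μ, (u : T →ₘ[μ] ℝ) t ≠ 0 →
        finiteBound (complementary Φ.toFun) t = ‖v t‖ₑ ∧ 0 ≤ (u : T →ₘ[μ] ℝ) t * v t := by
      filter_upwards [hii] with t ht hut
      exact (coe_eq_sign_mul_coe_iff hut).1 (ht hut)
    have hnn : ∀ᵐ t ∂μ, 0 ≤ (u : T →ₘ[μ] ℝ) t * v t := by
      filter_upwards [hii'] with t ht
      by_cases hut : (u : T →ₘ[μ] ℝ) t = 0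
      · simp [hut]
      · exact (ht hut).2
    -- Every competitor w satisfies |w| ≤ b_{Φ*} = |v| on the support of u, so v itself realizes the
    -- supremum.
    have hnorm : ‖u‖ ≤ ∫ t, (u : T →ₘ[μ] ℝ) t * v t ∂μ := by
      refine Φ.orliczNorm_le fun w hw => ?_
      rw [← ENNReal.ofReal_le_ofReal_iff (integral_nonneg_of_ae hnn),
        ofReal_integral_eq_lintegral_ofReal hint hnn, ← Real.norm_eq_abs, ofReal_norm]
      refine (enorm_integral_le_lintegral_enorm _).trans (lintegral_mono_ae ?_)
      filter_upwards [hii', hnn, OrliczSpace.ae_enorm_le_finiteBound hw] with t h1 h2 h3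
      rw [← Real.enorm_of_nonneg h2, enorm_mul, enorm_mul]
      by_cases hut : (u : T →ₘ[μ] ℝ) t = 0
      · simp [hut]
      · rw [(h1 hut).1] at h3
        gcongr
    have hu0 : 0 < ‖u‖ := norm_pos_iff.2 hu
    have h1 : f u ≤ ‖f‖ * ‖u‖ := (le_abs_self _).trans (f.le_opNorm u)
    rw [← hfu] at hnorm
    refine ⟨le_antisymm hf1 ?_, le_antisymm (h1.trans (mul_le_of_le_one_left hu0.le hf1)) hnorm⟩
    exact (le_mul_iff_one_le_left hu0).1 (hnorm.trans h1)
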